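/- \textbf{Model.} The nodes of a ring of size $n\ge 3$ are identical and anonymous (there is no landmark); the two ports of every node carry distinct labels from $\{0,1\}$, assigned arbitrarily at each node, so that they need not give a consistent orientation. Time is divided into synchronous rounds, and in each round at most one edge of the ring, chosen arbitrarily, is missing (the ring is 1-interval connected). Three agents start simultaneously at arbitrary, not necessarily distinct, nodes. They have pairwise distinct identifiers that are bit strings of the same length $k>1$. Each agent has its own consistent private notion of left and right; these notions need not agree (no chirality). All agents execute the same deterministic (computable) algorithm, which initially receives only the agent's identifier; in particular $n$ is unknown. In each round every active agent (i) exchanges messages with the other active agents at its node, and observes the port labels of the node and whether its attempt to move in the previous round, if any, failed; (ii) computes, from its memory, these observations and the received messages, its new memory and a decision: stay, try to move left, try to move right, or terminate; (iii) makes the chosen move, which succeeds exactly if the corresponding edge is not missing. Agents that cross the same edge in opposite directions in the same round do not notice each other, and a terminated agent never moves again and can no longer be detected. The algorithm \emph{solves Exploration with explicit termination within $T$ rounds} if after $T$ rounds every node has been visited by at least one agent and all three agents have terminated, and no agent decides to terminate before all nodes have been visited. \textbf{Theorem.} There is a single deterministic algorithm that, for all $k>1$ and $n\ge 3$, and for all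 choices of port labels, private orientations, starting nodes, distinct $k$-bit identifiers and missing edges as above, solves Exploration with explicit termination within $$k^2\,2^{k+\lceil\log_2 n\rceil+4}+23n$$ rounds. Moreover this bound is $O(k^2 2^k n)$: there is a constant $C$ such that $k^2\,2^{k+\lceil\log_2 n\rceil+4}+23n\le C\,k^2 2^k n$ for all $k>1$ and $n\ge 3$. -/

import Mathlib

namespace DynRing

/-- The possible outcomes of the Compute phase of an agent: do not move, attempt to move to the
(private) left, attempt to move to the (private) right, or terminate for good. -/
inductive Action where
  | stay
  | left
  | right
  | terminate
  deriving DecidableEq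

/-- A coding of the four actions, used only to speak about computable functions into `Action`. -/
def Action.equiv : Action ≃ Option (Option Bool) where
  toFun
    | .terminate => none
    | .stay => some none
    | .left => some (some false)
    | .right => some (some true)
  invFun
    | none => .terminate
    | some none => .stay
    | some (some false) => .left
    | some (some true) => .right
  left_inv a := by cases a <;> rfl
  right_inv a := by rcases a with _ | _ | _ | _ <;> rfl

instance : Primcodable Action := Primcodable.ofEquiv _ Action.equiv

/-- A deterministic algorithm, executed identically by all agents.

* `init` gives the initial memory as a function of the agent's own identifier, a bit string.
* In the Look phase an agent observes `rightPort`, the label (`true` or `false`) of the port of the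
  current node that lies in its private right direction (the other port has the other label), and
  `blocked`, telling whether its last round was a failed attempt to move.
  It broadcasts the message `send mem rightPort blocked` to the active agents at its node.
  Messages are finite data, coded as natural numbers.
* In the Compute phase it obtains its new memory and its action as
  `step mem rightPort blocked received`, where `received` is the list of the messages received from
  the other active agents at its node, in increasing order (so the list carries no information
  beyond the multiset of the messages).

All three functions are required to be computable. Nothing depends on the size of the ring. -/
structure Algorithm where
  State : Type
  [primcodable : Primcodable State]
  init : List Bool → State
  send : (mem : State) → (rightPort blocked : Bool) → ℕ
  step : (mem : State) → (rightPort blocked : Bool) → (received : List ℕ) → State × Action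
  computable_init : Computable init
  computable_send : Computable fun p : State × Bool × Bool => send p.1 p.2.1 p.2.2
  computable_step :
    Computable fun p : State × Bool × Bool × List ℕ => step p.1 p.2.1 p.2.2.1 p.2.2.2

/-- Everything outside the control of the algorithm, for three agents on a ring with node set
`ZMod n`. Node `v + 1` is the clockwise neighbour of `v`; the edge joining `v` and `v + 1` is
denoted by `v`.

* `port v` is the label of the clockwise port of `v`; the counterclockwise port is labelled
  `!port v`. The labels are arbitrary, and need not be consistent along the ring.
* `rightIsCW i` tells whether the private right of agent `i` is the clockwise direction; the
  agents need not agree.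
* `start i` is the initial node of agent `i`, and `id i` its identifier.
* `missing t` is the edge missing in round `t` (rounds are numbered from `0`), if any: at most one
  edge is missing, so that the ring is connected in every round. -/
structure Setting (n : ℕ) where
  port : ZMod n → Bool
  rightIsCW : Fin 3 → Bool
  start : Fin 3 → ZMod n
  id : Fin 3 → List Bool
  missing : ℕ → Option (ZMod n)

/-- A global configuration: for every agent its node, its memory, whether its last round was a
failed attempt to move, and whether it is still active (has not terminated). -/
structure Config (S : Type) (n : ℕ) where
  pos : Fin 3 → ZMod n
  mem : Fin 3 → S
  blocked : Fin 3 → Bool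
  active : Fin 3 → Bool

/-- The result of an attempt to move from `v`, clockwise if `cw` and counterclockwise otherwise,
while the edge `miss` is missing: the new node, and whether the attempt failed. -/
def attempt {n : ℕ} (miss : Option (ZMod n)) (v : ZMod n) (cw : Bool) : ZMod n × Bool :=
  if miss = some (if cw then v else v - 1) then (v, true)
  else (if cw then v + 1 else v - 1, false)

namespace Algorithm

variable (A : Algorithm) {n : ℕ} (E : Setting n)

/-- The label of the port in the private right direction of agent `i`, at its current node. -/
def rightPort (c : Config A.State n) (i : Fin 3) : Bool :=
  if E.rightIsCW i then E.port (c.pos i) else !E.port (c.pos i)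

/-- The message broadcast by agent `i`. -/
def message (c : Config A.State n) (i : Fin 3) : ℕ :=
  A.send (c.mem i) (A.rightPort E c i) (c.blocked i)

/-- The messages received by agent `i`: those of the other active agents at the same node. -/
def received (c : Config A.State n) (i : Fin 3) : List ℕ :=
  Multiset.sort
    (((Finset.univ.filter fun j : Fin 3 => j ≠ i ∧ c.active j = true ∧ c.pos j = c.pos i).val).map
      (A.message E c))

/-- What agent `i`, if active, computes in configuration `c`. -/
def compute (c : Config A.State n) (i : Fin 3) : A.State × Action :=
  A.step (c.mem i) (A.rightPort E c i) (c.blocked i) (A.received E c i)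

/-- The new node of agent `i` after its Move phase, and whether it failed to move. -/
def move (miss : Option (ZMod n)) (c : Config A.State n) (i : Fin 3) : ZMod n × Bool :=
  match (A.compute E c i).2 with
  | .right => attempt miss (c.pos i) (E.rightIsCW i)
  | .left => attempt miss (c.pos i) (!E.rightIsCW i)
  | .stay => (c.pos i, false)
  | .terminate => (c.pos i, false)

/-- One synchronous round, in which the edge `miss` is missing. -/
def next (miss : Option (ZMod n)) (c : Config A.State n) : Config A.State n where
  pos i := if c.active i then (A.move E miss c i).1 else c.pos i
  mem i := if c.active i then (A.compute E c i).1 else c.mem i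
  blocked i := if c.active i then (A.move E miss c i).2 else c.blocked i
  active i := c.active i && decide ((A.compute E c i).2 ≠ Action.terminate)

/-- The configuration after `t` rounds. -/
def run : ℕ → Config A.State n
  | 0 =>
    { pos := E.start
      mem := fun i => A.init (E.id i)
      blocked := fun _ => false
      active := fun _ => true }
  | t + 1 => A.next E (E.missing t) (run t)

/-- The algorithm solves Exploration with explicit termination within `T` rounds: every node has
been visited by some agent and all three agents have terminated after `T` rounds, and no agent
decides to terminate before every node has been visited. -/
def ExploresWithin (T : ℕ) : Prop :=
  (∀ v : ZMod n, ∃ s ≤ T, ∃ j, (A.run E s).pos j = v) ∧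
  (∀ i, (A.run E T).active i = false) ∧
  (∀ t i, (A.run E t).active i = false → ∀ v : ZMod n, ∃ s < t, ∃ j, (A.run E s).pos j = v)

end Algorithm

/-- The round bound `k² 2^(k + ⌈log₂ n⌉ + 4) + 23 n`. -/
def roundBound (k n : ℕ) : ℕ := k ^ 2 * 2 ^ (k + Nat.clog 2 n + 4) + 23 * n

end DynRing

/-! Time is cut into phases; in a phase all slots have the same length `L`, which starts at 4 and
doubles. All clocks agree, so the agents always know the current phase and slot (`Sync`). A phase
has `4 k² + 4` slots.

Gathering uses `4 k²` slots, indexed by two bit positions `p`, `q` and two parities. Bit `p` decides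
who moves. Among three distinct identifiers some position separates two agents from the third, so
some slots make exactly those two move. A further position `q` where these two differ lets them move
in a common direction, whether or not their orientations agree (`exists_good_slot`). Two distinct
agents moving in the same direction are never blocked in the same round, so if `2 n ≤ L` somebody
meets somebody within the slot (`exists_meet_of_chase`), and agents that are together stay together.

In the measuring slot two agents that are together walk apart in opposite directions. Each counts
its failed moves, and earns `L` points when it comes back to the standing agent. If the two scores
add up to `L`, then either a walker has gone around the ring, or the walkers failed so often that
they must have been blocked simultaneously at the two ends of one edge. In both cases `n ≤ L`, and
then the walk has explored the ring (`le_of_le_scores`, `explored_of_opposite`). Conversely the sum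
reaches `L` as soon as `4 n ≤ L` (`le_scores`).

The last three slots bring the scores together and arrange a common termination. The walkers turn to
one direction and chase the third agent, so that two agents meet. Such a pair splits up, and one of
the two reaches the remaining agent (`meet_of_split`); the resulting pair then knows both scores. If
a pair knows a sum of at least `L`, it decides to stop and splits up once more to inform the third
agent. Since the sum certifies `n ≤ L`, this succeeds within the slot, and all three terminate in
its last round (`inactive_of_high`). Otherwise nobody stops and the clocks stay synchronous
(`next_phase`). Thus termination is sound in every phase and certain once `4 n ≤ L`. The lengths
form a geometric series, so only `O(k² n)` rounds are used, well below the stated bound. -/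

namespace DynRing

/-! ### The algorithm: memory, updates and actions -/

open Encodable

/-- The memory of an agent executing the exploration algorithm.

Rounds are grouped into slots of `len` rounds each, and slots into phases; `slot` and `timer` tell
the current slot of the phase and the current round of the slot. -/
structure Mem where
  id : List Bool
  len : ℕ
  slot : ℕ
  timer : ℕ
  /-- whether the agent is a walker (as opposed to standing still) -/
  walks : Bool
  /-- the private direction in which a walker walks, `true` meaning right -/
  dir : Bool
  /-- whether the agent is the leading one of the two walkers -/
  lead : Bool
  /-- whether a walker has already met the agent standing still -/
  seen : Bool
  /-- whether the agent has decided to terminate at the end of the phase -/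
  fin : Bool
  /-- what the agent knows of the score of the leading walker -/
  scoreA : ℕ
  /-- what the agent knows of the score of the other walker -/
  scoreB : ℕ

namespace Mem

/-- The memory as a tuple. -/
def equiv : Mem ≃
    (List Bool × ℕ × ℕ × ℕ) × (Bool × Bool × Bool × Bool × Bool) × ℕ × ℕ where
  toFun m := ((m.id, m.len, m.slot, m.timer), (m.walks, m.dir, m.lead, m.seen, m.fin),
    m.scoreA, m.scoreB)
  invFun x := ⟨x.1.1, x.1.2.1, x.1.2.2.1, x.1.2.2.2, x.2.1.1, x.2.1.2.1, x.2.1.2.2.1,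
    x.2.1.2.2.2.1, x.2.1.2.2.2.2, x.2.2.1, x.2.2.2⟩
  left_inv _ := rfl
  right_inv _ := rfl

instance : Primcodable Mem := Primcodable.ofEquiv _ equiv

/-- The initial memory. -/
def start (id : List Bool) : Mem := ⟨id, 4, 0, 0, false, false, false, false, false, 0, 0⟩

/-- The number of slots of a phase that serve to bring two agents together. -/
def gather (m : Mem) : ℕ := 4 * (m.id.length * m.id.length)

/-- The message of an agent: its memory, and the label of its right port. -/
def msg (m : Mem) (rp : Bool) : ℕ := encode (m, rp)

/-- The content of a message. -/
def view (x : ℕ) : Mem × Bool := (decode x).getD (start [], false)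

@[simp]
theorem view_msg (m : Mem) (rp : Bool) : view (msg m rp) = (m, rp) := by
  simp [view, msg]

theorem msg_injective {m m' : Mem} {rp rp' : Bool} (h : msg m rp = msg m' rp') : m = m' := by
  have := encode_injective h
  simp_all

/-- Choose the two walkers among the agents at the node, the first one going to its right and the
second one in the opposite direction. Three agents at one node do so only if `triple`. -/
def assign (triple : Bool) (m : Mem) (own : ℕ) (rp : Bool) (l : List ℕ) : Mem :=
  let lower := l.any fun x => decide (x < own)
  let upper := l.any fun x => decide (own < x)
  { m with
    -- Among three agents the one with the largest message is excluded: it has a smaller message and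
    -- no larger one at its node.
    walks := l.length == 1 || (triple && l.length != 0 && (!lower || upper))
    lead := !lower
    -- The smallest message goes right. The second walker compares right-port labels at the common
    -- node: equal labels mean equal orientation, hence it goes left. The conjunction extracts the
    -- label of the only smaller message.
    dir := !lower || xor rp (l.any fun x => decide (x < own) && (view x).2) }

/-- Clear the scores. -/
def clear (m : Mem) : Mem := { m with seen := false, scoreA := 0, scoreB := 0 }

/-- What a walker adds to its score: `1` for a failed move, and `len` if it has returned to the
agent standing still. -/
def gain (m : Mem) (bl met : Bool) : ℕ :=
  -- An unblocked walker has just moved, so finding the standing agent then is a genuine return;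
  -- waiting next to it behind a missing edge earns only the failure point.
  if m.walks then (if bl then 1 else if m.seen && met then m.len else 0) else 0

/-- Update the scores of a walker. -/
def count (m : Mem) (bl : Bool) (l : List ℕ) : Mem :=
  let met := l.any fun x => !(view x).1.walks
  { m with
    seen := m.seen || met
    scoreA := m.scoreA + if m.lead then m.gain bl met else 0
    scoreB := m.scoreB + if m.lead then 0 else m.gain bl met }

/-- Learn the scores known to the agents at the node. -/
def merge (m : Mem) (l : List ℕ) : Mem :=
  { m with
    scoreA := l.foldr (fun x r => max (view x).1.scoreA r) m.scoreA
    scoreB := l.foldr (fun x r => max (view x).1.scoreB r) m.scoreB }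

/-- Decide on termination. -/
def decideFin (m : Mem) (l : List ℕ) : Mem :=
  { m with
    fin := m.fin || (l.any fun x => (view x).1.fin) ||
      -- Company is required because a lone agent could not be sure to inform the others. Deciding
      -- in the first round leaves enough rounds for the pair to reach the third agent.
      (m.timer == 0 && l.length != 0 && decide (m.len ≤ m.scoreA + m.scoreB)) }

/-- The new memory, except for the clock. -/
def update (m : Mem) (rp bl : Bool) (l : List ℕ) : Mem :=
  if decide (m.slot < m.gather) then m
  else if m.slot == m.gather then
    if m.timer == 0 then (m.assign true (m.msg rp) rp l).clear else m.count bl l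
  else if m.slot == m.gather + 1 then m.merge l
  else
    let m₁ := if m.timer == 0 then (m.merge l).assign false (m.msg rp) rp l else m.merge l
    if m.slot == m.gather + 2 then m₁ else m₁.decideFin l

/-- Advance the clock. -/
def tick (m : Mem) : Mem :=
  if decide (m.timer + 1 < m.len) then { m with timer := m.timer + 1 }
  else if decide (m.slot < m.gather + 3) then { m with timer := 0, slot := m.slot + 1 }
  else { m with timer := 0, slot := 0, len := 2 * m.len }

/-- Move in the given private direction. -/
def go (d : Bool) : Action := if d then .right else .left

/-- The bit of the identifier that decides whether the agent moves in slot `s`. -/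
def moveBit (id : List Bool) (s : ℕ) : Bool := id.getD (s / 4 / id.length) false

/-- The bit of the identifier that may decide where the agent moves in slot `s`. -/
def dirBit (id : List Bool) (s : ℕ) : Bool := id.getD (s / 4 % id.length) false

/-- Whether an agent that is alone moves in slot `s`, one of those that serve to bring two agents
together. -/
def seeks (id : List Bool) (s : ℕ) : Bool := xor (moveBit id s) (s % 2 == 0)

/-- The private direction in which the agent moves in slot `s`. -/
def seekDir (id : List Bool) (s : ℕ) : Bool := s / 2 % 2 == 0 || dirBit id s

/-- The action, as a function of the new memory with the old clock. -/
def act (m : Mem) (l : List ℕ) : Action :=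
  if decide (m.slot < m.gather) then
    if l.length == 0 && seeks m.id m.slot then go (seekDir m.id m.slot) else .stay
  else if m.slot == m.gather then if m.walks then go m.dir else .stay
  else if m.slot == m.gather + 1 then
    -- The leader keeps its direction and the other walker reverses, so the two opposite directions
    -- become one.
    if l.length == 0 && m.walks then go (m.dir == m.lead) else .stay
  else if m.slot == m.gather + 3 && m.fin && m.timer + 1 == m.len then .terminate
  -- In the first round the pair has to leave although it is in company; afterwards any company
  -- stops a walker.
  else if m.walks && (m.timer == 0 || l.length == 0) then go m.dir else .stay

/-- The new memory and the action. -/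
def step (m : Mem) (rp bl : Bool) (l : List ℕ) : Mem × Action :=
  ((m.update rp bl l).tick, (m.update rp bl l).act l)

/-! ### Computability -/

theorem primrec_equiv : Primrec equiv := Primrec.of_equiv

section

variable {α : Type*} [Primcodable α]

theorem primrec_mk {f₁ : α → List Bool} {f₂ f₃ f₄ : α → ℕ} {f₅ f₆ f₇ f₈ f₉ : α → Bool}
    {f₁₀ f₁₁ : α → ℕ} (h₁ : Primrec f₁) (h₂ : Primrec f₂) (h₃ : Primrec f₃) (h₄ : Primrec f₄)
    (h₅ : Primrec f₅) (h₆ : Primrec f₆) (h₇ : Primrec f₇) (h₈ : Primrec f₈) (h₉ : Primrec f₉)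
    (h₁₀ : Primrec f₁₀) (h₁₁ : Primrec f₁₁) :
    Primrec fun a => Mem.mk (f₁ a) (f₂ a) (f₃ a) (f₄ a) (f₅ a) (f₆ a) (f₇ a) (f₈ a) (f₉ a)
      (f₁₀ a) (f₁₁ a) :=
  (Primrec.of_equiv_symm (e := equiv)).comp
    ((h₁.pair (h₂.pair (h₃.pair h₄))).pair
      ((h₅.pair (h₆.pair (h₇.pair (h₈.pair h₉)))).pair (h₁₀.pair h₁₁)))

variable {f : α → Mem} {b c : α → Bool} {u v : α → ℕ} {g : α → List ℕ}

theorem primrec_id (hf : Primrec f) : Primrec fun a => (f a).id :=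
  (Primrec.fst.comp (Primrec.fst.comp primrec_equiv)).comp hf

theorem primrec_len (hf : Primrec f) : Primrec fun a => (f a).len :=
  (Primrec.fst.comp (Primrec.snd.comp (Primrec.fst.comp primrec_equiv))).comp hf

theorem primrec_slot (hf : Primrec f) : Primrec fun a => (f a).slot :=
  (Primrec.fst.comp (Primrec.snd.comp (Primrec.snd.comp (Primrec.fst.comp primrec_equiv)))).comp hf

theorem primrec_timer (hf : Primrec f) : Primrec fun a => (f a).timer :=
  (Primrec.snd.comp (Primrec.snd.comp (Primrec.snd.comp (Primrec.fst.comp primrec_equiv)))).comp hf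

theorem primrec_flags (hf : Primrec f) : Primrec fun a =>
    ((f a).walks, (f a).dir, (f a).lead, (f a).seen, (f a).fin) :=
  (Primrec.fst.comp (Primrec.snd.comp primrec_equiv)).comp hf

theorem primrec_walks (hf : Primrec f) : Primrec fun a => (f a).walks :=
  Primrec.fst.comp (primrec_flags hf)

theorem primrec_dir (hf : Primrec f) : Primrec fun a => (f a).dir :=
  Primrec.fst.comp (Primrec.snd.comp (primrec_flags hf))

theorem primrec_lead (hf : Primrec f) : Primrec fun a => (f a).lead :=
  Primrec.fst.comp (Primrec.snd.comp (Primrec.snd.comp (primrec_flags hf)))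

theorem primrec_seen (hf : Primrec f) : Primrec fun a => (f a).seen :=
  Primrec.fst.comp (Primrec.snd.comp (Primrec.snd.comp (Primrec.snd.comp (primrec_flags hf))))

theorem primrec_fin (hf : Primrec f) : Primrec fun a => (f a).fin :=
  Primrec.snd.comp (Primrec.snd.comp (Primrec.snd.comp (Primrec.snd.comp (primrec_flags hf))))

theorem primrec_scoreA (hf : Primrec f) : Primrec fun a => (f a).scoreA :=
  (Primrec.fst.comp (Primrec.snd.comp (Primrec.snd.comp primrec_equiv))).comp hf

theorem primrec_scoreB (hf : Primrec f) : Primrec fun a => (f a).scoreB :=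
  (Primrec.snd.comp (Primrec.snd.comp (Primrec.snd.comp primrec_equiv))).comp hf

theorem primrec_gather (hf : Primrec f) : Primrec fun a => (f a).gather :=
  have h := Primrec.list_length.comp (primrec_id hf)
  Primrec.nat_mul.comp (Primrec.const 4) (Primrec.nat_mul.comp h h)

theorem primrec_msg (hf : Primrec f) (hb : Primrec b) : Primrec fun a => (f a).msg (b a) :=
  Primrec.encode.comp (hf.pair hb)

theorem primrec_view (hu : Primrec u) : Primrec fun a => view (u a) :=
  Primrec.option_getD.comp (Primrec.decode.comp hu) (Primrec.const (start [], false))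

theorem primrec_or (hb : Primrec b) (hc : Primrec c) : Primrec fun a => b a || c a :=
  Primrec.or.comp hb hc

theorem primrec_and (hb : Primrec b) (hc : Primrec c) : Primrec fun a => b a && c a :=
  Primrec.and.comp hb hc

theorem primrec_not (hb : Primrec b) : Primrec fun a => !b a :=
  Primrec.not.comp hb

theorem primrec_xor (hb : Primrec b) (hc : Primrec c) : Primrec fun a => xor (b a) (c a) :=
  (Primrec.dom_finite fun x : Bool × Bool => xor x.1 x.2).comp (hb.pair hc)

theorem primrec_lt (hu : Primrec u) (hv : Primrec v) : Primrec fun a => decide (u a < v a) :=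
  (Primrec.nat_lt.comp hu hv).decide

theorem primrec_le (hu : Primrec u) (hv : Primrec v) : Primrec fun a => decide (u a ≤ v a) :=
  (Primrec.nat_le.comp hu hv).decide

theorem primrec_beq (hu : Primrec u) (hv : Primrec v) : Primrec fun a => u a == v a :=
  Primrec.beq.comp hu hv

theorem primrec_beq_bool (hb : Primrec b) (hc : Primrec c) : Primrec fun a => b a == c a :=
  Primrec.beq.comp hb hc

theorem primrec_add (hu : Primrec u) (hv : Primrec v) : Primrec fun a => u a + v a :=
  Primrec.nat_add.comp hu hv

theorem primrec_ite {β : Type*} [Primcodable β] {p q : α → β} (hb : Primrec b) (hp : Primrec p)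
    (hq : Primrec q) : Primrec fun a => if b a then p a else q a :=
  (Primrec.cond hb hp hq).of_eq fun a => by cases b a <;> rfl

theorem primrec_any {p : α → ℕ → Bool} (hg : Primrec g)
    (hp : Primrec fun x : α × ℕ => p x.1 x.2) : Primrec fun a => (g a).any (p a) := by
  have h : Primrec₂ fun (a : α) (x : ℕ × Bool) => p a x.1 || x.2 :=
    primrec_or (hp.comp (Primrec.fst.pair (Primrec.fst.comp Primrec.snd)))
      (Primrec.snd.comp Primrec.snd)
  refine (Primrec.list_foldr hg (Primrec.const false) h).of_eq fun a => ?_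
  induction g a with
  | nil => rfl
  | cons x l ih => simp [ih]

theorem primrec_foldr_max {p : ℕ → ℕ} (hg : Primrec g) (hu : Primrec u) (hp : Primrec p) :
    Primrec fun a => (g a).foldr (fun x r => max (p x) r) (u a) := by
  have h : Primrec₂ fun (_ : α) (x : ℕ × ℕ) => max (p x.1) x.2 :=
    Primrec.nat_max.comp (hp.comp (Primrec.fst.comp Primrec.snd)) (Primrec.snd.comp Primrec.snd)
  exact Primrec.list_foldr hg hu h

theorem primrec_isNil (hg : Primrec g) : Primrec fun a => (g a).length == 0 :=
  primrec_beq (Primrec.list_length.comp hg) (Primrec.const 0)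

theorem primrec_assign (t : Bool) (hf : Primrec f) (hu : Primrec u) (hb : Primrec b)
    (hg : Primrec g) : Primrec fun a => assign t (f a) (u a) (b a) (g a) := by
  have hlow : Primrec fun x : α × ℕ => decide (x.2 < u x.1) :=
    primrec_lt Primrec.snd (hu.comp Primrec.fst)
  have hlower := primrec_any (p := fun a x => decide (x < u a)) hg hlow
  have hupper := primrec_any (p := fun a x => decide (u a < x)) hg
    (primrec_lt (hu.comp Primrec.fst) Primrec.snd)
  have hlen := Primrec.list_length.comp hg
  exact primrec_mk (primrec_id hf) (primrec_len hf) (primrec_slot hf) (primrec_timer hf)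
    (primrec_or (primrec_beq hlen (Primrec.const 1)) (primrec_and (primrec_and (Primrec.const t)
      (primrec_not (primrec_isNil hg))) (primrec_or (primrec_not hlower) hupper)))
    (primrec_or (primrec_not hlower) (primrec_xor hb (primrec_any
      (p := fun a x => decide (x < u a) && (view x).2) hg (primrec_and hlow (Primrec.snd.comp (primrec_view Primrec.snd))))))
    (primrec_not hlower) (primrec_seen hf) (primrec_fin hf) (primrec_scoreA hf)
    (primrec_scoreB hf)

theorem primrec_clear (hf : Primrec f) : Primrec fun a => (f a).clear :=
  primrec_mk (primrec_id hf) (primrec_len hf) (primrec_slot hf) (primrec_timer hf)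
    (primrec_walks hf) (primrec_dir hf) (primrec_lead hf) (Primrec.const false) (primrec_fin hf)
    (Primrec.const 0) (Primrec.const 0)

theorem primrec_gain (hf : Primrec f) (hb : Primrec b) (hc : Primrec c) :
    Primrec fun a => (f a).gain (b a) (c a) :=
  primrec_ite (primrec_walks hf) (primrec_ite hb (Primrec.const 1) (primrec_ite
    (primrec_and (primrec_seen hf) hc) (primrec_len hf) (Primrec.const 0))) (Primrec.const 0)

theorem primrec_count (hf : Primrec f) (hb : Primrec b) (hg : Primrec g) :
    Primrec fun a => (f a).count (b a) (g a) := by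
  have hmet : Primrec fun a => (g a).any fun x => !(view x).1.walks :=
    primrec_any hg (primrec_not (primrec_walks (Primrec.fst.comp (primrec_view Primrec.snd))))
  exact primrec_mk (primrec_id hf) (primrec_len hf) (primrec_slot hf) (primrec_timer hf)
    (primrec_walks hf) (primrec_dir hf) (primrec_lead hf) (primrec_or (primrec_seen hf) hmet)
    (primrec_fin hf)
    (primrec_add (primrec_scoreA hf) (primrec_ite (primrec_lead hf) (primrec_gain hf hb hmet)
      (Primrec.const 0)))
    (primrec_add (primrec_scoreB hf) (primrec_ite (primrec_lead hf) (Primrec.const 0)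
      (primrec_gain hf hb hmet)))

theorem primrec_merge (hf : Primrec f) (hg : Primrec g) : Primrec fun a => (f a).merge (g a) :=
  primrec_mk (primrec_id hf) (primrec_len hf) (primrec_slot hf) (primrec_timer hf)
    (primrec_walks hf) (primrec_dir hf) (primrec_lead hf) (primrec_seen hf) (primrec_fin hf)
    (primrec_foldr_max hg (primrec_scoreA hf)
      (primrec_scoreA (Primrec.fst.comp (primrec_view Primrec.id))))
    (primrec_foldr_max hg (primrec_scoreB hf)
      (primrec_scoreB (Primrec.fst.comp (primrec_view Primrec.id))))

theorem primrec_decideFin (hf : Primrec f) (hg : Primrec g) :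
    Primrec fun a => (f a).decideFin (g a) :=
  primrec_mk (primrec_id hf) (primrec_len hf) (primrec_slot hf) (primrec_timer hf)
    (primrec_walks hf) (primrec_dir hf) (primrec_lead hf) (primrec_seen hf)
    (primrec_or (primrec_or (primrec_fin hf)
      (primrec_any hg (primrec_fin (Primrec.fst.comp (primrec_view Primrec.snd)))))
      (primrec_and (primrec_and (primrec_beq (primrec_timer hf) (Primrec.const 0))
        (primrec_not (primrec_isNil hg)))
        (primrec_le (primrec_len hf) (primrec_add (primrec_scoreA hf) (primrec_scoreB hf)))))
    (primrec_scoreA hf) (primrec_scoreB hf)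

theorem primrec_slot_beq (hf : Primrec f) (i : ℕ) :
    Primrec fun a => (f a).slot == (f a).gather + i :=
  primrec_beq (primrec_slot hf) (primrec_add (primrec_gather hf) (Primrec.const i))

theorem primrec_update (hf : Primrec f) (hb : Primrec b) (hc : Primrec c) (hg : Primrec g) :
    Primrec fun a => (f a).update (b a) (c a) (g a) := by
  have ht := primrec_beq (primrec_timer hf) (Primrec.const 0)
  have h1 := primrec_ite ht (primrec_assign false (primrec_merge hf hg) (primrec_msg hf hb) hb hg)
    (primrec_merge hf hg)
  exact primrec_ite (primrec_lt (primrec_slot hf) (primrec_gather hf)) hf <|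
    primrec_ite (primrec_slot_beq hf 0)
      (primrec_ite ht (primrec_clear (primrec_assign true hf (primrec_msg hf hb) hb hg))
        (primrec_count hf hc hg)) <|
    primrec_ite (primrec_slot_beq hf 1) (primrec_merge hf hg) <|
    primrec_ite (primrec_slot_beq hf 2) h1 (primrec_decideFin h1 hg)

theorem primrec_tick (hf : Primrec f) : Primrec fun a => (f a).tick := by
  have mk : ∀ {s t l : α → ℕ}, Primrec s → Primrec t → Primrec l → Primrec fun a =>
      ({ f a with timer := t a, slot := s a, len := l a } : Mem) := fun hs ht hl =>
    primrec_mk (primrec_id hf) hl hs ht (primrec_walks hf) (primrec_dir hf) (primrec_lead hf)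
      (primrec_seen hf) (primrec_fin hf) (primrec_scoreA hf) (primrec_scoreB hf)
  have hsucc := Primrec.succ.comp (primrec_timer hf)
  exact primrec_ite (primrec_lt hsucc (primrec_len hf))
    (mk (primrec_slot hf) hsucc (primrec_len hf)) <|
    primrec_ite (primrec_lt (primrec_slot hf)
      (primrec_add (primrec_gather hf) (Primrec.const 3)))
      (mk (Primrec.succ.comp (primrec_slot hf)) (Primrec.const 0) (primrec_len hf))
      (mk (Primrec.const 0) (Primrec.const 0)
        (Primrec.nat_mul.comp (Primrec.const 2) (primrec_len hf)))

theorem primrec_go (hb : Primrec b) : Primrec fun a => go (b a) :=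
  (Primrec.dom_finite go).comp hb

theorem primrec_act (hf : Primrec f) (hg : Primrec g) : Primrec fun a => (f a).act (g a) := by
  have hs := primrec_slot hf
  have hlen := Primrec.list_length.comp (primrec_id hf)
  have h4 := Primrec.nat_div.comp hs (Primrec.const 4)
  have hmb : Primrec fun a => moveBit (f a).id (f a).slot :=
    (Primrec.list_getD false).comp (primrec_id hf) (Primrec.nat_div.comp h4 hlen)
  have hdb : Primrec fun a => dirBit (f a).id (f a).slot :=
    (Primrec.list_getD false).comp (primrec_id hf) (Primrec.nat_mod.comp h4 hlen)
  have hseeks : Primrec fun a => seeks (f a).id (f a).slot :=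
    primrec_xor hmb (primrec_beq (Primrec.nat_mod.comp hs (Primrec.const 2)) (Primrec.const 0))
  have hsd : Primrec fun a => seekDir (f a).id (f a).slot :=
    primrec_or (primrec_beq (Primrec.nat_mod.comp (Primrec.nat_div.comp hs (Primrec.const 2))
      (Primrec.const 2)) (Primrec.const 0)) hdb
  have hstay : Primrec fun _ : α => Action.stay := Primrec.const _
  have hdir := primrec_go (primrec_dir hf)
  exact primrec_ite (primrec_lt hs (primrec_gather hf))
      (primrec_ite (primrec_and (primrec_isNil hg) hseeks) (primrec_go hsd) hstay) <|
    primrec_ite (primrec_slot_beq hf 0) (primrec_ite (primrec_walks hf) hdir hstay) <|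
    primrec_ite (primrec_slot_beq hf 1)
      (primrec_ite (primrec_and (primrec_isNil hg) (primrec_walks hf))
        (primrec_go (primrec_beq_bool (primrec_dir hf) (primrec_lead hf))) hstay) <|
    primrec_ite (primrec_and (primrec_and (primrec_slot_beq hf 3) (primrec_fin hf))
        (primrec_beq (Primrec.succ.comp (primrec_timer hf)) (primrec_len hf)))
      (Primrec.const Action.terminate)
      (primrec_ite (primrec_and (primrec_walks hf) (primrec_or
        (primrec_beq (primrec_timer hf) (Primrec.const 0)) (primrec_isNil hg))) hdir hstay)

end

theorem primrec_start : Primrec start :=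
  primrec_mk Primrec.id (Primrec.const _) (Primrec.const _) (Primrec.const _) (Primrec.const _)
    (Primrec.const _) (Primrec.const _) (Primrec.const _) (Primrec.const _) (Primrec.const _)
    (Primrec.const _)

end Mem

/-- The exploration algorithm. -/
def explore : Algorithm where
  State := Mem
  init := Mem.start
  send m rp _ := m.msg rp
  step := Mem.step
  computable_init := Mem.primrec_start.to_comp
  computable_send :=
    (Mem.primrec_msg Primrec.fst (Primrec.fst.comp Primrec.snd)).to_comp
  computable_step := by
    have h := Mem.primrec_update (α := Mem × Bool × Bool × List ℕ) Primrec.fst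
      (Primrec.fst.comp Primrec.snd) (Primrec.fst.comp (Primrec.snd.comp Primrec.snd))
      (Primrec.snd.comp (Primrec.snd.comp Primrec.snd))
    exact ((Mem.primrec_tick h).pair
      (Mem.primrec_act h (Primrec.snd.comp (Primrec.snd.comp Primrec.snd)))).to_comp

/-! ### Walks on the ring -/

/-- The displacement of a successful move. -/
def sgn (n : ℕ) (g : Bool) : ZMod n := if g then 1 else -1

section Walks

variable {n : ℕ} {g : Bool} {miss : Option (ZMod n)} {x y u v : ZMod n}

theorem sgn_not : sgn n (!g) = -sgn n g := by cases g <;> simp [sgn]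

theorem sgn_mul_self : sgn n g * sgn n g = 1 := by cases g <;> simp [sgn]

theorem sgn_mul_eq_zero : sgn n g * x = 0 ↔ x = 0 := by cases g <;> simp [sgn]

theorem attempt_eq : attempt miss v g = (v, true) ∨ attempt miss v g = (v + sgn n g, false) := by
  unfold attempt sgn
  split_ifs <;> simp [sub_eq_add_neg]

theorem attempt_cases : ((attempt miss v g).2 = true ∧ (attempt miss v g).1 = v) ∨
    ((attempt miss v g).2 = false ∧ (attempt miss v g).1 = v + sgn n g) := by
  rcases attempt_eq (miss := miss) (v := v) (g := g) with h | h <;> simp [h]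

theorem attempt_blocked : (attempt miss v g).2 = true ↔
    miss = some (if g then v else v - 1) := by
  unfold attempt
  by_cases h : miss = some (if g then v else v - 1) <;> simp [h]

/-- Only one edge is missing, and in a given direction each edge is entered from a single node.
Hence two separate agents heading the same way cannot both fail. -/
theorem eq_of_attempt_blocked (hx : (attempt miss x g).2 = true)
    (hy : (attempt miss y g).2 = true) : x = y := by
  rw [attempt_blocked] at hx hy
  rw [hx] at hy
  cases g <;> simpa using hy

/-- Opposite attempts fail together only at the two ends of the one missing edge, facing each other.
-/
theorem eq_add_sgn_of_attempt_blocked (hx : (attempt miss x g).2 = true)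
    (hy : (attempt miss y !g).2 = true) : y = x + sgn n g := by
  rw [attempt_blocked] at hx hy
  rw [hx] at hy
  cases g <;> simp [sgn] at hy ⊢
  · rw [← hy]; ring
  · rw [hy]; ring

/-- Every node lies ahead, at a distance between `1` and `n`. -/
theorem exists_steps (hn : 3 ≤ n) (g : Bool) (u v : ZMod n) :
    ∃ r : ℕ, 0 < r ∧ r ≤ n ∧ v = u + sgn n g * r ∧ (v ≠ u → r < n) := by
  have : NeZero n := ⟨by omega⟩
  have key : ∀ w : ZMod n, w = sgn n g * (v - u) → v = u + sgn n g * w := by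
    rintro w rfl
    rw [← mul_assoc, sgn_mul_self]; ring
  by_cases h : v = u
  · exact ⟨n, by omega, le_rfl, by simp [h], fun h' => absurd h h'⟩
  · have hlt := ZMod.val_lt (sgn n g * (v - u))
    have hpos : 0 < (sgn n g * (v - u)).val := by
      rw [Nat.pos_iff_ne_zero, Ne, ZMod.val_eq_zero, sgn_mul_eq_zero, sub_eq_zero]
      exact h
    exact ⟨_, hpos, hlt.le, key _ (ZMod.natCast_zmod_val _), fun _ => hlt⟩

theorem add_sgn_mul_inj {a b : ℕ} (h : u + sgn n g * a = u + sgn n g * b) (hab : a < b) :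
    n ≤ b - a := by
  have h1 : sgn n g * ((b - a : ℕ) : ZMod n) = 0 := by
    rw [Nat.cast_sub hab.le, mul_sub, sub_eq_zero]
    exact (add_left_cancel h).symm
  rw [sgn_mul_eq_zero, ZMod.natCast_eq_zero_iff] at h1
  exact Nat.le_of_dvd (by omega) h1

/-- Two agents that walked away from a node in opposite directions and are now separated by one
edge have walked all along the ring. -/
theorem le_of_adjacent {a b : ℕ} (h : u + sgn n (!g) * b = u + sgn n g * a + sgn n g) :
    n ≤ a + b + 1 := by
  have h1 : sgn n g * ((a + b + 1 : ℕ) : ZMod n) = 0 := by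
    rw [sgn_not] at h
    push_cast
    linear_combination -h
  rw [sgn_mul_eq_zero, ZMod.natCast_eq_zero_iff] at h1
  exact Nat.le_of_dvd (by omega) h1

variable {missing : ℕ → Option (ZMod n)} {pos : ℕ → Fin 3 → ZMod n}

/-- Two agents moving in the same direction and one standing still: two of them meet. -/
theorem exists_meet_of_chase (hn : 3 ≤ n) {a b c : Fin 3} (hab : a ≠ b) (hac : a ≠ c) (hbc : b ≠ c)
    {L : ℕ} (hL : 2 * n ≤ L)
    (hmove : ∀ τ < L, (∀ i j, i ≠ j → pos τ i ≠ pos τ j) →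
      pos (τ + 1) a = (attempt (missing τ) (pos τ a) g).1 ∧
      pos (τ + 1) b = (attempt (missing τ) (pos τ b) g).1 ∧ pos (τ + 1) c = pos τ c)
    (hstay : ∀ τ < L, ∀ i j, i ≠ j → pos τ i = pos τ j → pos (τ + 1) i = pos (τ + 1) j) :
    ∃ i j, i ≠ j ∧ pos L i = pos L j := by
  by_contra! hne
  -- A meeting would persist until the end, so its absence at time `L` excludes it at all earlier
  -- times.
  have hne' : ∀ τ, τ ≤ L → ∀ i j, i ≠ j → pos τ i ≠ pos τ j := by
    intro τ hτ
    induction hτ using Nat.decreasingInduction with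
    | self => exact hne
    | of_succ τ hτ ih => exact fun i j hij h => ih i j hij (hstay τ hτ i j hij h)
  obtain ⟨r, hr0, -, hr, hr'⟩ := exists_steps hn g (pos 0 a) (pos 0 c)
  obtain ⟨q, hq0, -, hq, hq'⟩ := exists_steps hn g (pos 0 b) (pos 0 c)
  replace hr' := hr' (hne' 0 (by omega) _ _ hac.symm)
  replace hq' := hq' (hne' 0 (by omega) _ _ hbc.symm)
  -- Neither mover has covered its distance to `c`, both less than `n`, while every round adds a
  -- step to at least one of them. At `τ = L ≥ 2 n` this is impossible.
  have key : ∀ τ, τ ≤ L → pos τ c = pos 0 c ∧ ∃ d e : ℕ, pos τ a = pos 0 a + sgn n g * d ∧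
      pos τ b = pos 0 b + sgn n g * e ∧ d < r ∧ e < q ∧ τ ≤ d + e := by
    intro τ
    induction τ with
    | zero => exact fun _ => ⟨rfl, 0, 0, by simp, by simp, hr0, hq0, le_rfl⟩
    | succ τ ih =>
      intro hτ
      obtain ⟨hc, d, e, hd, he, hdr, heq, hle⟩ := ih (by omega)
      obtain ⟨ha, hb, hc'⟩ := hmove τ (by omega) (hne' τ (by omega))
      have hca := hne' (τ + 1) hτ _ _ hac
      have hcb := hne' (τ + 1) hτ _ _ hbc
      rw [hc', hc] at hca hcb ⊢
      refine ⟨rfl, ?_⟩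
      have hda : pos (τ + 1) a = pos 0 a + sgn n g * (d + 1 : ℕ) → d + 1 < r := by
        intro h
        refine lt_of_le_of_ne hdr fun h' => hca ?_
        rw [h, h', ← hr]
      have heb : pos (τ + 1) b = pos 0 b + sgn n g * (e + 1 : ℕ) → e + 1 < q := by
        intro h
        refine lt_of_le_of_ne heq fun h' => hcb ?_
        rw [h, h', ← hq]
      rcases attempt_cases (miss := missing τ) (v := pos τ a) (g := g) with ⟨ba, ma⟩ | ⟨ba, ma⟩ <;>
      rcases attempt_cases (miss := missing τ) (v := pos τ b) (g := g) with ⟨bb, mb⟩ | ⟨bb, mb⟩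
      · exact absurd (eq_of_attempt_blocked ba bb) (hne' τ (by omega) _ _ hab)
      · rw [mb, he] at hb
        rw [ma] at ha
        have hb' : pos (τ + 1) b = pos 0 b + sgn n g * (e + 1 : ℕ) := by
          rw [hb]; push_cast; ring
        exact ⟨d, e + 1, by rw [ha, hd], hb', hdr, heb hb', by omega⟩
      · rw [ma, hd] at ha
        rw [mb] at hb
        have ha' : pos (τ + 1) a = pos 0 a + sgn n g * (d + 1 : ℕ) := by
          rw [ha]; push_cast; ring
        exact ⟨d + 1, e, ha', by rw [hb, he], hda ha', heq, by omega⟩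
      · rw [ma, hd] at ha
        rw [mb, he] at hb
        have ha' : pos (τ + 1) a = pos 0 a + sgn n g * (d + 1 : ℕ) := by
          rw [ha]; push_cast; ring
        have hb' : pos (τ + 1) b = pos 0 b + sgn n g * (e + 1 : ℕ) := by
          rw [hb]; push_cast; ring
        exact ⟨d + 1, e + 1, ha', hb', hda ha', heb hb', by omega⟩
  obtain ⟨-, d, e, -, -, hd, he, hle⟩ := key L le_rfl
  omega

/-- Two agents leaving a node in opposite directions, each until it meets somebody, and one agent
standing still elsewhere: one of the two reaches it. -/
theorem meet_of_split (hn : 3 ≤ n) {a b c : Fin 3} (hab : a ≠ b) (hac : a ≠ c) (hbc : b ≠ c)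
    (huniv : ∀ i, i = a ∨ i = b ∨ i = c) {L : ℕ} (h0 : pos 0 a = pos 0 b) (h0c : pos 0 c ≠ pos 0 a)
    (hc : ∀ τ < L, pos (τ + 1) c = pos τ c)
    (hmove : ∀ τ < L, ∀ i d, (i = a ∧ d = g ∨ i = b ∧ d = !g) →
      (τ = 0 ∨ ∀ j, j ≠ i → pos τ j ≠ pos τ i) →
      pos (τ + 1) i = (attempt (missing τ) (pos τ i) d).1)
    (hstay : ∀ τ < L, ∀ i, i = a ∨ i = b → τ ≠ 0 → (∃ j, j ≠ i ∧ pos τ j = pos τ i) →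
      pos (τ + 1) i = pos τ i)
    {τ : ℕ} (hτ : n ≤ τ + 1) (hτL : τ ≤ L) : pos τ a = pos τ c ∨ pos τ b = pos τ c := by
  obtain ⟨r, hr0, -, hr, hr'⟩ := exists_steps hn g (pos 0 a) (pos 0 c)
  replace hr' := hr' h0c
  have hr2 : pos 0 c = pos 0 a + sgn n (!g) * ((n - r : ℕ) : ZMod n) := by
    rw [hr, Nat.cast_sub hr'.le, sgn_not]; simp
  -- The distances to `c` along the two arcs are `r` and `n - r`. Until one of them is covered,
  -- every round adds a step, so `n - 1` rounds suffice.
  have key : ∀ τ, τ ≤ L → pos τ c = pos 0 c ∧ (pos τ a = pos τ c ∨ pos τ b = pos τ c ∨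
      ∃ d e : ℕ, pos τ a = pos 0 a + sgn n g * d ∧
      pos τ b = pos 0 a + sgn n (!g) * e ∧ d < r ∧ e < n - r ∧ τ ≤ d + e) := by
    intro τ
    induction τ with
    | zero => exact fun _ => ⟨rfl, .inr (.inr ⟨0, 0, by simp, by simp [h0], hr0, by omega, le_rfl⟩)⟩
    | succ τ ih =>
      intro hτ
      obtain ⟨ihc, ih⟩ := ih (by omega)
      have hcτ := hc τ (by omega)
      refine ⟨by rw [hcτ, ihc], ?_⟩
      rcases ih with h | h | ⟨d, e, hd, he, hdr, her, hle⟩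
      · left
        rw [hcτ, hstay τ (by omega) a (.inl rfl) _ ⟨c, hac.symm, h.symm⟩, h]
        rintro rfl
        exact h0c h.symm
      · right; left
        rw [hcτ, hstay τ (by omega) b (.inr rfl) _ ⟨c, hbc.symm, h.symm⟩, h]
        rintro rfl
        exact h0c (by rw [h0, h])
      · rw [hcτ, ihc]
        have hac' : pos τ a ≠ pos 0 c := by
          rw [hd, hr]
          intro h
          have := add_sgn_mul_inj h hdr
          omega
        have hbc' : pos τ b ≠ pos 0 c := by
          rw [he, hr2]
          intro h
          have := add_sgn_mul_inj h her
          omega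
        -- After the start the walkers cannot meet each other before reaching `c`: that would make
        -- `d + e` a positive multiple of `n`, but `d + e < n`.
        have hab' : τ = 0 ∨ pos τ a ≠ pos τ b := by
          by_contra! h
          have h2 : pos 0 a + sgn n g * (0 : ℕ) = pos 0 a + sgn n g * (d + e : ℕ) := by
            have := h.2
            rw [hd, he, sgn_not] at this
            push_cast
            linear_combination -this
          have := add_sgn_mul_inj h2 (by omega)
          omega
        have ha : pos (τ + 1) a = (attempt (missing τ) (pos τ a) g).1 := by
          refine hmove τ (by omega) a g (.inl ⟨rfl, rfl⟩) (hab'.imp_right fun h j hj => ?_)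
          rcases huniv j with rfl | rfl | rfl
          · exact absurd rfl hj
          · exact h.symm
          · rw [ihc]; exact hac'.symm
        have hb : pos (τ + 1) b = (attempt (missing τ) (pos τ b) !g).1 := by
          refine hmove τ (by omega) b _ (.inr ⟨rfl, rfl⟩) (hab'.imp_right fun h j hj => ?_)
          rcases huniv j with rfl | rfl | rfl
          · exact h
          · exact absurd rfl hj
          · rw [ihc]; exact hbc'.symm
        have hda : pos (τ + 1) a = pos 0 a + sgn n g * (d + 1 : ℕ) →
            pos (τ + 1) a = pos 0 c ∨ d + 1 < r := by
          intro h
          rcases eq_or_lt_of_le (Nat.succ_le_of_lt hdr) with h' | h'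
          · left; rw [h, hr, ← h']
          · exact .inr h'
        have heb : pos (τ + 1) b = pos 0 a + sgn n (!g) * (e + 1 : ℕ) →
            pos (τ + 1) b = pos 0 c ∨ e + 1 < n - r := by
          intro h
          rcases eq_or_lt_of_le (Nat.succ_le_of_lt her) with h' | h'
          · left; rw [h, hr2, ← h']
          · exact .inr h'
        rcases attempt_cases (miss := missing τ) (v := pos τ a) (g := g) with
          ⟨ba, ma⟩ | ⟨ba, ma⟩ <;>
        rcases attempt_cases (miss := missing τ) (v := pos τ b) (g := !g) with ⟨bb, mb⟩ | ⟨bb, mb⟩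
        -- If both were blocked, the walked arcs would miss just one edge, and `c` would already
        -- have been passed.
        · have h := eq_add_sgn_of_attempt_blocked ba bb
          rw [hd, he] at h
          have := le_of_adjacent h
          omega
        · rw [mb, he] at hb
          rw [ma] at ha
          have hb' : pos (τ + 1) b = pos 0 a + sgn n (!g) * (e + 1 : ℕ) := by
            rw [hb]; push_cast; ring
          rcases heb hb' with h | h
          · exact .inr (.inl h)
          · exact .inr (.inr ⟨d, e + 1, by rw [ha, hd], hb', hdr, h, by omega⟩)
        · rw [ma, hd] at ha
          rw [mb] at hb
          have ha' : pos (τ + 1) a = pos 0 a + sgn n g * (d + 1 : ℕ) := by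
            rw [ha]; push_cast; ring
          rcases hda ha' with h | h
          · exact .inl h
          · exact .inr (.inr ⟨d + 1, e, ha', by rw [hb, he], h, her, by omega⟩)
        · rw [ma, hd] at ha
          rw [mb, he] at hb
          have ha' : pos (τ + 1) a = pos 0 a + sgn n g * (d + 1 : ℕ) := by
            rw [ha]; push_cast; ring
          have hb' : pos (τ + 1) b = pos 0 a + sgn n (!g) * (e + 1 : ℕ) := by
            rw [hb]; push_cast; ring
          rcases hda ha' with h | h
          · exact .inl h
          rcases heb hb' with h' | h'
          · exact .inr (.inl h')
          · exact .inr (.inr ⟨d + 1, e + 1, ha', hb', h, h', by omega⟩)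
  obtain ⟨-, h | h | ⟨d, e, -, -, h1, h2, h3⟩⟩ := key τ hτL
  · exact .inl h
  · exact .inr h
  · omega

end Walks

/-! ### Counting the successful moves of persistent walkers -/

section Count

variable {n : ℕ} {g : Bool} {missing : ℕ → Option (ZMod n)} {x y : ℕ → ZMod n}
  {bx bz : ℕ → Bool} {L : ℕ}

/-- The number of successes among the first `τ` attempts, `b (τ + 1)` telling whether attempt `τ`
failed. -/
def moves (b : ℕ → Bool) (τ : ℕ) : ℕ := ((Finset.range τ).filter fun s => b (s + 1) = false).card

@[simp]
theorem moves_zero (b : ℕ → Bool) : moves b 0 = 0 := rfl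

theorem moves_succ (b : ℕ → Bool) (τ : ℕ) :
    moves b (τ + 1) = moves b τ + if b (τ + 1) then 0 else 1 := by
  unfold moves
  rw [Finset.range_add_one, Finset.filter_insert]
  split_ifs with h h' <;> simp_all

theorem moves_le (b : ℕ → Bool) (τ : ℕ) : moves b τ ≤ τ :=
  (Finset.card_filter_le _ _).trans_eq (Finset.card_range τ)

theorem exists_moves_eq (b : ℕ → Bool) {τ r : ℕ} (h : r ≤ moves b τ) :
    ∃ s ≤ τ, moves b s = r := by
  induction τ with
  | zero => exact ⟨0, le_rfl, by simp at h ⊢; omega⟩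
  | succ τ ih =>
    by_cases h' : r ≤ moves b τ
    · obtain ⟨s, hs, hs'⟩ := ih h'
      exact ⟨s, by omega, hs'⟩
    · refine ⟨τ + 1, le_rfl, ?_⟩
      rw [moves_succ] at h ⊢
      split_ifs at h ⊢ <;> omega

/-- An agent that keeps walking is found where the number of its successful moves says. -/
theorem pos_eq_moves
    (h : ∀ τ < L, (x (τ + 1), bx (τ + 1)) = attempt (missing τ) (x τ) g) {τ : ℕ} (hτ : τ ≤ L) :
    x τ = x 0 + sgn n g * moves bx τ := by
  induction τ with
  | zero => simp
  | succ τ ih =>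
    have h1 := h τ (by omega)
    rcases attempt_eq (miss := missing τ) (v := x τ) (g := g) with h2 | h2
    · rw [h2, Prod.mk.injEq] at h1
      rw [moves_succ, h1.1, h1.2, ih (by omega), if_pos rfl, add_zero]
    · rw [h2, Prod.mk.injEq] at h1
      rw [moves_succ, h1.1, h1.2, ih (by omega), if_neg Bool.false_ne_true]
      push_cast
      ring

/-- Two agents that walk in opposite directions from a node: either they have moved as many times
as rounds have passed, or they have explored the ring. -/
theorem le_moves_add_moves (hxy : x 0 = y 0)
    (hx : ∀ τ < L, (x (τ + 1), bx (τ + 1)) = attempt (missing τ) (x τ) g)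
    (hy : ∀ τ < L, (y (τ + 1), bz (τ + 1)) = attempt (missing τ) (y τ) !g) {τ : ℕ} (hτ : τ ≤ L) :
    τ ≤ moves bx τ + moves bz τ ∨ n ≤ moves bx τ + moves bz τ + 1 := by
  induction τ with
  | zero => simp
  | succ τ ih =>
    rw [moves_succ, moves_succ]
    rcases ih (by omega) with h | h
    -- A round without any success has both walkers at the ends of the missing edge, with every
    -- other edge of the ring walked.
    · by_cases hb : bx (τ + 1) = true ∧ bz (τ + 1) = true
      · right
        have h1 : (attempt (missing τ) (x τ) g).2 = true := by rw [← hx τ (by omega)]; exact hb.1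
        have h2 : (attempt (missing τ) (y τ) !g).2 = true := by rw [← hy τ (by omega)]; exact hb.2
        have h3 := eq_add_sgn_of_attempt_blocked h1 h2
        rw [pos_eq_moves hx (by omega), pos_eq_moves hy (by omega), hxy] at h3
        have := le_of_adjacent h3
        omega
      · left
        cases h1 : bx (τ + 1) <;> cases h2 : bz (τ + 1) <;> simp_all <;> omega
    · right; omega

/-- Two agents that walk in opposite directions from a node for `n` rounds explore the ring. -/
theorem explored_of_opposite (hn : 3 ≤ n) (hL : n ≤ L) (hxy : x 0 = y 0)
    (hx : ∀ τ < L, (x (τ + 1), bx (τ + 1)) = attempt (missing τ) (x τ) g)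
    (hy : ∀ τ < L, (y (τ + 1), bz (τ + 1)) = attempt (missing τ) (y τ) !g) (v : ZMod n) :
    ∃ τ ≤ L, x τ = v ∨ y τ = v := by
  have hd : n ≤ moves bx L + moves bz L + 1 := by
    rcases le_moves_add_moves hxy hx hy le_rfl with h | h <;> omega
  obtain ⟨r, hr0, hrn, hr, -⟩ := exists_steps hn g (x 0) v
  -- A total of `n - 1` moves suffices: if the first walker made fewer than `r` moves, the other one
  -- made at least `n - r`.
  by_cases hrx : r ≤ moves bx L
  · obtain ⟨τ, hτ, h⟩ := exists_moves_eq bx hrx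
    exact ⟨τ, hτ, .inl (by rw [pos_eq_moves hx hτ, h, hr])⟩
  · obtain ⟨τ, hτ, h⟩ := exists_moves_eq bz (τ := L) (r := n - r) (by omega)
    refine ⟨τ, hτ, .inr ?_⟩
    rw [pos_eq_moves hy hτ, h, hr, sgn_not, Nat.cast_sub hrn, hxy]
    simp

end Count

/-! ### Rounds of the algorithm -/

namespace Mem

variable {m : Mem} {t : Bool} {own : ℕ} {rp bl : Bool} {l : List ℕ}

@[simp] theorem update_id : (m.update rp bl l).id = m.id := by
  unfold update; split_ifs <;> rfl

@[simp] theorem update_len : (m.update rp bl l).len = m.len := by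
  unfold update; split_ifs <;> rfl

@[simp] theorem update_slot : (m.update rp bl l).slot = m.slot := by
  unfold update; split_ifs <;> rfl

@[simp] theorem update_timer : (m.update rp bl l).timer = m.timer := by
  unfold update; split_ifs <;> rfl

@[simp] theorem update_gather : (m.update rp bl l).gather = m.gather := by
  simp [gather]

/-- The decision to terminate can be taken only in the last slot of a phase. -/
theorem update_fin (h : m.slot ≠ m.gather + 3) (h' : m.slot ≤ m.gather + 3) :
    (m.update rp bl l).fin = m.fin := by
  have : m.slot < m.gather ∨ m.slot = m.gather ∨ m.slot = m.gather + 1 ∨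
    m.slot = m.gather + 2 := by omega
  unfold update
  split_ifs <;> first | rfl | (exfalso; simp at *; omega)

@[simp] theorem tick_id : m.tick.id = m.id := by unfold tick; split_ifs <;> rfl
@[simp] theorem tick_walks : m.tick.walks = m.walks := by unfold tick; split_ifs <;> rfl
@[simp] theorem tick_dir : m.tick.dir = m.dir := by unfold tick; split_ifs <;> rfl
@[simp] theorem tick_lead : m.tick.lead = m.lead := by unfold tick; split_ifs <;> rfl
@[simp] theorem tick_seen : m.tick.seen = m.seen := by unfold tick; split_ifs <;> rfl
@[simp] theorem tick_fin : m.tick.fin = m.fin := by unfold tick; split_ifs <;> rfl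
@[simp] theorem tick_scoreA : m.tick.scoreA = m.scoreA := by unfold tick; split_ifs <;> rfl
@[simp] theorem tick_scoreB : m.tick.scoreB = m.scoreB := by unfold tick; split_ifs <;> rfl

theorem foldr_max_le {f : ℕ → ℕ} {a c : ℕ} :
    l.foldr (fun x r => max (f x) r) a ≤ c ↔ a ≤ c ∧ ∀ x ∈ l, f x ≤ c := by
  induction l with
  | nil => simp
  | cons x l ih => simp [ih]; tauto

theorem act_ne_terminate (h : ¬ (m.slot = m.gather + 3 ∧ m.fin = true ∧ m.timer + 1 = m.len)) :
    m.act l ≠ .terminate := by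
  have hgo : ∀ d, go d ≠ .terminate := by decide
  unfold act
  split_ifs with h1 h2 h3 h4 h5 h6 h7
  all_goals first | exact hgo _ | exact Action.noConfusion | (exfalso; simp_all)

end Mem

variable {n : ℕ} (E : Setting n)

/-- The configuration after `t` rounds. -/
def conf (t : ℕ) : Config Mem n := explore.run E t

/-- The node of agent `i` after `t` rounds. -/
def place (t : ℕ) (i : Fin 3) : ZMod n := (conf E t).pos i

/-- The memory of agent `i` after `t` rounds. -/
def mind (t : ℕ) (i : Fin 3) : Mem := (conf E t).mem i

/-- Whether agent `i` failed to move in the last one of `t` rounds. -/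
def failed (t : ℕ) (i : Fin 3) : Bool := (conf E t).blocked i

/-- The label of the right port of agent `i` after `t` rounds. -/
def label (t : ℕ) (i : Fin 3) : Bool := explore.rightPort E (conf E t) i

/-- The messages received by agent `i` after `t` rounds. -/
def heard (t : ℕ) (i : Fin 3) : List ℕ := explore.received E (conf E t) i

/-- The message of agent `i` after `t` rounds. -/
def said (t : ℕ) (i : Fin 3) : ℕ := (mind E t i).msg (label E t i)

/-- What agent `i` has computed after `t` rounds, before it advances its clock. -/
def upd (t : ℕ) (i : Fin 3) : Mem :=
  (mind E t i).update (label E t i) (failed E t i) (heard E t i)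

/-- All agents are active. -/
def Awake (t : ℕ) : Prop := ∀ i, (conf E t).active i = true

/-- Whether the private direction `d` of agent `i` is the clockwise direction. -/
def clockwise (i : Fin 3) (d : Bool) : Bool := d == E.rightIsCW i

variable {E} {t : ℕ} {i j k : Fin 3}

theorem mind_succ (h : Awake E t) : mind E (t + 1) i = (upd E t i).tick :=
  if_pos (h i)

theorem active_succ (h : Awake E t) : (conf E (t + 1)).active i =
    decide ((upd E t i).act (heard E t i) ≠ .terminate) := by
  have : (conf E (t + 1)).active i = ((conf E t).active i &&
    decide ((upd E t i).act (heard E t i) ≠ .terminate)) := rfl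
  rw [this, h i, Bool.true_and]

theorem place_of_go (h : Awake E t) {d : Bool} (hd : (upd E t i).act (heard E t i) = Mem.go d) :
    (place E (t + 1) i, failed E (t + 1) i) =
      attempt (E.missing t) (place E t i) (clockwise E i d) := by
  have h1 : (place E (t + 1) i, failed E (t + 1) i) =
      explore.move E (E.missing t) (conf E t) i :=
    Prod.ext (if_pos (h i)) (if_pos (h i))
  have h2 : (explore.compute E (conf E t) i).2 = Mem.go d := hd
  rw [h1]
  unfold Algorithm.move
  rw [h2, place, clockwise]
  cases d <;> cases E.rightIsCW i <;> simp [Mem.go]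

theorem place_of_stay (h : Awake E t) (hd : (upd E t i).act (heard E t i) = .stay) :
    place E (t + 1) i = place E t i := by
  have h1 : place E (t + 1) i = (explore.move E (E.missing t) (conf E t) i).1 := if_pos (h i)
  have h2 : (explore.compute E (conf E t) i).2 = .stay := hd
  rw [h1]
  unfold Algorithm.move
  rw [h2]
  rfl

theorem mem_heard (h : Awake E t) {x : ℕ} :
    x ∈ heard E t i ↔ ∃ j, j ≠ i ∧ place E t j = place E t i ∧ said E t j = x := by
  have h' : ∀ j, (conf E t).active j = true := h
  unfold heard Algorithm.received
  rw [Multiset.mem_sort]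
  simp only [Multiset.mem_map, Finset.mem_val, Finset.mem_filter, Finset.mem_univ, true_and, h' ,
    and_assoc]
  rfl

theorem any_heard (h : Awake E t) {p : ℕ → Bool} : (heard E t i).any p = true ↔
    ∃ j, j ≠ i ∧ place E t j = place E t i ∧ p (said E t j) = true := by
  rw [List.any_eq_true]
  constructor
  · rintro ⟨x, hx, hp⟩
    obtain ⟨j, h1, h2, rfl⟩ := (mem_heard h).1 hx
    exact ⟨j, h1, h2, hp⟩
  · rintro ⟨j, h1, h2, hp⟩
    exact ⟨_, (mem_heard h).2 ⟨j, h1, h2, rfl⟩, hp⟩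

theorem exists_third (hij : i ≠ j) :
    ∃ k, i ≠ k ∧ j ≠ k ∧ ∀ x, x = i ∨ x = j ∨ x = k := by
  revert i j; decide

theorem cover (hij : i ≠ j) (hik : i ≠ k) (hjk : j ≠ k) (x : Fin 3) : x = i ∨ x = j ∨ x = k := by
  revert i j k x; decide

theorem length_heard (h : Awake E t) (hij : i ≠ j) (hik : i ≠ k) (hjk : j ≠ k) :
    (heard E t i).length = (if place E t j = place E t i then 1 else 0) +
      if place E t k = place E t i then 1 else 0 := by
  have h' : ∀ j, (conf E t).active j = true := h
  unfold heard Algorithm.received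
  rw [Multiset.length_sort, Multiset.card_map]
  change Finset.card _ = _
  rw [Finset.card_filter]
  have hu : (Finset.univ : Finset (Fin 3)) = {i, j, k} := by
    ext x; simpa using cover hij hik hjk x
  rw [hu, Finset.sum_insert (by simp [hij, hik]), Finset.sum_insert (by simp [hjk]),
    Finset.sum_singleton]
  simp only [ne_eq, not_true_eq_false, false_and, if_false, hij.symm, hik.symm, not_false_eq_true,
    h', true_and, place, zero_add]
  congr

theorem length_heard_eq_zero (h : Awake E t) :
    ((heard E t i).length == 0) = true ↔ ∀ j, j ≠ i → place E t j ≠ place E t i := by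
  rw [beq_iff_eq, List.length_eq_zero_iff, List.eq_nil_iff_forall_not_mem]
  constructor
  · exact fun h1 j hj hp => h1 _ ((mem_heard h).2 ⟨j, hj, hp, rfl⟩)
  · intro h1 x hx
    obtain ⟨j, hj, hp, -⟩ := (mem_heard h).1 hx
    exact h1 j hj hp

theorem view_said : Mem.view (said E t i) = (mind E t i, label E t i) := Mem.view_msg ..

/-- Describes the merged score as a maximum by its upper bounds `c`; taking `c` to be the merged
score itself gives the lower bounds. -/
theorem merge_scoreA_le (h : Awake E t) {c : ℕ} :
    ((mind E t i).merge (heard E t i)).scoreA ≤ c ↔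
      ∀ j, place E t j = place E t i → (mind E t j).scoreA ≤ c := by
  refine Mem.foldr_max_le.trans ⟨fun ⟨h1, h2⟩ j hj => ?_, fun h1 => ⟨h1 i rfl, fun x hx => ?_⟩⟩
  · by_cases hji : j = i
    · exact hji ▸ h1
    · simpa [view_said] using h2 _ ((mem_heard h).2 ⟨j, hji, hj, rfl⟩)
  · obtain ⟨j, hj, hp, rfl⟩ := (mem_heard h).1 hx
    simpa [view_said] using h1 j hp

theorem merge_scoreB_le (h : Awake E t) {c : ℕ} :
    ((mind E t i).merge (heard E t i)).scoreB ≤ c ↔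
      ∀ j, place E t j = place E t i → (mind E t j).scoreB ≤ c := by
  refine Mem.foldr_max_le.trans ⟨fun ⟨h1, h2⟩ j hj => ?_, fun h1 => ⟨h1 i rfl, fun x hx => ?_⟩⟩
  · by_cases hji : j = i
    · exact hji ▸ h1
    · simpa [view_said] using h2 _ ((mem_heard h).2 ⟨j, hji, hj, rfl⟩)
  · obtain ⟨j, hj, hp, rfl⟩ := (mem_heard h).1 hx
    simpa [view_said] using h1 j hp

/-! ### Assignment of roles to agents sharing a node -/

variable (E) in
/-- The outcome of the assignment of roles by agent `i`. -/
def role (triple : Bool) (t : ℕ) (i : Fin 3) (m : Mem) : Mem :=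
  m.assign triple (said E t i) (label E t i) (heard E t i)

variable (E) in
/-- Agents `i` and `j` are the first and the second walker, and agent `k` stands still. -/
structure Roles (w : Fin 3 → Mem) (i j k : Fin 3) : Prop where
  walks_fst : (w i).walks = true
  lead_fst : (w i).lead = true
  walks_snd : (w j).walks = true
  lead_snd : (w j).lead = false
  walks_thd : (w k).walks = false
  opposite : clockwise E j (w j).dir = !clockwise E i (w i).dir

/-- At a common node, right-port labels agree exactly when the orientations do, so their `xor` tells
the second walker which of its directions opposes the right of the first. -/
theorem opposite_aux (hp : place E t i = place E t j) :
    clockwise E j (xor (label E t j) (label E t i)) = !clockwise E i true := by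
  have h1 : ∀ i, label E t i =
      if E.rightIsCW i then E.port (place E t i) else !E.port (place E t i) := fun _ => rfl
  rw [h1, h1, ← hp, clockwise, clockwise]
  cases E.rightIsCW i <;> cases E.rightIsCW j <;> cases E.port (place E t i) <;> rfl

theorem roles_of_pair (h : Awake E t) (hij : i ≠ j) (hik : i ≠ k) (hjk : j ≠ k)
    (hp : place E t i = place E t j) (hk : place E t k ≠ place E t i)
    (hlt : said E t i < said E t j) (triple : Bool) (w : Fin 3 → Mem) :
    Roles E (fun x => role E triple t x (w x)) i j k := by
  have li : (heard E t i).length = 1 := by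
    rw [length_heard h hij hik hjk, if_pos hp.symm, if_neg hk]
  have lj : (heard E t j).length = 1 := by
    rw [length_heard h hij.symm hjk hik, if_pos hp, if_neg (hp ▸ hk)]
  have lk : (heard E t k).length = 0 := by
    rw [length_heard h hik.symm hjk.symm hij, if_neg hk.symm, if_neg (hp ▸ hk.symm)]
  have ai : ((heard E t i).any fun x => decide (x < said E t i)) = false := by
    rw [Bool.eq_false_iff, Ne, any_heard h]
    rintro ⟨x, hx, hxp, hx'⟩
    rcases cover hij hik hjk x with rfl | rfl | rfl
    · exact hx rfl
    · simp at hx'; omega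
    · exact hk hxp
  have aj : ((heard E t j).any fun x => decide (x < said E t j)) = true :=
    (any_heard h).2 ⟨i, hij, hp, by simpa using hlt⟩
  have bj : ((heard E t j).any fun x => decide (x < said E t j) && (Mem.view x).2) =
      label E t i := by
    rw [Bool.eq_iff_iff, any_heard h]
    constructor
    · rintro ⟨x, hx, hxp, hx'⟩
      rcases cover hij hik hjk x with rfl | rfl | rfl
      · simp [view_said] at hx'; exact hx'.2
      · exact absurd rfl hx
      · exact absurd (hxp.trans hp.symm) hk
    · exact fun hl => ⟨i, hij, hp, by simpa [view_said, hlt] using hl⟩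
  constructor
  · simp [role, Mem.assign, li]
  · simp [role, Mem.assign, ai]
  · simp [role, Mem.assign, lj]
  · simp [role, Mem.assign, aj]
  · simp [role, Mem.assign, lk]
  · simpa [role, Mem.assign, ai, aj, bj] using opposite_aux hp

theorem roles_of_triple (h : Awake E t) (hij : i ≠ j) (hik : i ≠ k) (hjk : j ≠ k)
    (hp : place E t i = place E t j) (hk : place E t k = place E t i)
    (hlt : said E t i < said E t j) (hlt' : said E t j < said E t k) (w : Fin 3 → Mem) :
    Roles E (fun x => role E true t x (w x)) i j k := by
  have li : (heard E t i).length = 2 := by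
    rw [length_heard h hij hik hjk, if_pos hp.symm, if_pos hk]
  have lj : (heard E t j).length = 2 := by
    rw [length_heard h hij.symm hjk hik, if_pos hp, if_pos (hp ▸ hk)]
  have lk : (heard E t k).length = 2 := by
    rw [length_heard h hik.symm hjk.symm hij, if_pos hk.symm, if_pos (hp ▸ hk.symm)]
  have ai : ((heard E t i).any fun x => decide (x < said E t i)) = false := by
    rw [Bool.eq_false_iff, Ne, any_heard h]
    rintro ⟨x, hx, hxp, hx'⟩
    rcases cover hij hik hjk x with rfl | rfl | rfl
    · exact hx rfl
    · simp at hx'; omega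
    · simp at hx'; omega
  have aj : ((heard E t j).any fun x => decide (x < said E t j)) = true :=
    (any_heard h).2 ⟨i, hij, hp, by simpa using hlt⟩
  have uj : ((heard E t j).any fun x => decide (said E t j < x)) = true :=
    (any_heard h).2 ⟨k, hjk.symm, hk.trans hp, by simpa using hlt'⟩
  have ak : ((heard E t k).any fun x => decide (x < said E t k)) = true :=
    (any_heard h).2 ⟨j, hjk, (hk.trans hp).symm, by simpa using hlt'⟩
  have uk : ((heard E t k).any fun x => decide (said E t k < x)) = false := by
    rw [Bool.eq_false_iff, Ne, any_heard h]
    rintro ⟨x, hx, hxp, hx'⟩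
    rcases cover hij hik hjk x with rfl | rfl | rfl
    · simp at hx'; omega
    · simp at hx'; omega
    · exact hx rfl
  have bj : ((heard E t j).any fun x => decide (x < said E t j) && (Mem.view x).2) =
      label E t i := by
    rw [Bool.eq_iff_iff, any_heard h]
    constructor
    · rintro ⟨x, hx, hxp, hx'⟩
      rcases cover hij hik hjk x with rfl | rfl | rfl
      · simp [view_said] at hx'; exact hx'.2
      · exact absurd rfl hx
      · simp at hx'; omega
    · exact fun hl => ⟨i, hij, hp, by simpa [view_said, hlt] using hl⟩
  constructor
  · simp [role, Mem.assign, li, ai]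
  · simp [role, Mem.assign, ai]
  · simp [role, Mem.assign, lj, aj, uj]
  · simp [role, Mem.assign, aj]
  · simp [role, Mem.assign, lk, ak, uk]
  · simpa [role, Mem.assign, ai, aj, bj] using opposite_aux hp

/-- An agent that is alone does not walk. -/
theorem role_of_alone (h : Awake E t) (ha : ∀ j, j ≠ i → place E t j ≠ place E t i)
    (triple : Bool) (m : Mem) : (role E triple t i m).walks = false := by
  have := (length_heard_eq_zero h).2 ha
  rw [beq_iff_eq] at this
  simp [role, Mem.assign, this]

/-- If all agents are together, and this is not allowed for, then nobody walks. -/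
theorem role_of_together (h : Awake E t) (ha : ∀ i j, place E t i = place E t j) (m : Mem) :
    (role E false t i m).walks = false := by
  obtain ⟨j, hj⟩ := exists_ne i
  obtain ⟨k, h1, h2, -⟩ := exists_third hj.symm
  have : (heard E t i).length = 2 := by
    rw [length_heard h hj.symm h1 h2, if_pos (ha _ _), if_pos (ha _ _)]
  simp [role, Mem.assign, this]

/-! ### The clock -/

variable (E) in
/-- All agents are active, and are in round `τ` of slot `s`, the slots having `L` rounds. -/
structure Sync (L s τ t : ℕ) : Prop where
  awake : Awake E t
  id : ∀ i, (mind E t i).id = E.id i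
  len : ∀ i, (mind E t i).len = L
  slot : ∀ i, (mind E t i).slot = s
  timer : ∀ i, (mind E t i).timer = τ

variable {L s τ K : ℕ}

theorem Sync.gather (H : Sync E L s τ t) (hK : ∀ i, (E.id i).length = K) (i : Fin 3) :
    (mind E t i).gather = 4 * (K * K) := by
  rw [Mem.gather, H.id, hK]

/-- A message encodes the whole memory, including the identifier; so comparing messages breaks every
tie. -/
theorem Sync.said_ne (H : Sync E L s τ t) (hinj : Function.Injective E.id) (hij : i ≠ j) :
    said E t i ≠ said E t j := by
  intro h
  have := Mem.msg_injective h
  exact hij (hinj (by rw [← H.id, ← H.id, this]))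

/-- Termination happens only in the last round of the last slot, and only with `fin` set. -/
theorem Sync.awake_succ (H : Sync E L s τ t) (hK : ∀ i, (E.id i).length = K)
    (hfin : s ≠ 4 * (K * K) + 3 ∨ τ + 1 ≠ L ∨ ∀ i, (upd E t i).fin = false) :
    Awake E (t + 1) := by
  intro i
  rw [active_succ H.awake, decide_eq_true_eq]
  refine Mem.act_ne_terminate ?_
  rintro ⟨h1, h2, h3⟩
  simp only [upd, Mem.update_slot, Mem.update_gather, Mem.update_timer, Mem.update_len, H.slot,
    H.gather hK, H.timer, H.len] at h1 h3
  rcases hfin with h | h | h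
  · exact h h1
  · exact h h3
  · exact Bool.false_ne_true ((h i).symm.trans h2)

theorem Sync.succ (H : Sync E L s τ t) (hK : ∀ i, (E.id i).length = K) (hτ : τ + 1 < L) :
    Sync E L s (τ + 1) (t + 1) := by
  have ht : ∀ i, (upd E t i).tick = { upd E t i with timer := (upd E t i).timer + 1 } := by
    intro i
    rw [Mem.tick, if_pos]
    simpa [upd, H.timer, H.len] using hτ
  refine ⟨H.awake_succ hK (.inr (.inl (by omega))), fun i => ?_, fun i => ?_, fun i => ?_,
    fun i => ?_⟩ <;> rw [mind_succ H.awake, ht] <;> simp [upd, H.id, H.len, H.slot, H.timer]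

theorem Sync.succ_slot (H : Sync E L s τ t) (hK : ∀ i, (E.id i).length = K) (hτ : τ + 1 = L)
    (hs : s < 4 * (K * K) + 3) : Sync E L (s + 1) 0 (t + 1) := by
  have ht : ∀ i, (upd E t i).tick =
      { upd E t i with timer := 0, slot := (upd E t i).slot + 1 } := by
    intro i
    rw [Mem.tick, if_neg, if_pos]
    · simpa [upd, H.slot, H.gather hK] using hs
    · simp [upd, H.timer, H.len, hτ]
  refine ⟨H.awake_succ hK (.inl (by omega)), fun i => ?_, fun i => ?_, fun i => ?_,
    fun i => ?_⟩ <;> rw [mind_succ H.awake, ht] <;> simp [upd, H.id, H.len, H.slot]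

theorem Sync.succ_phase (H : Sync E L s τ t) (hK : ∀ i, (E.id i).length = K) (hτ : τ + 1 = L)
    (hs : s = 4 * (K * K) + 3) (hfin : ∀ i, (upd E t i).fin = false) :
    Sync E (2 * L) 0 0 (t + 1) := by
  have ht : ∀ i, (upd E t i).tick =
      { upd E t i with timer := 0, slot := 0, len := 2 * (upd E t i).len } := by
    intro i
    rw [Mem.tick, if_neg, if_neg]
    · simp [upd, H.slot, H.gather hK, hs]
    · simp [upd, H.timer, H.len, hτ]
  refine ⟨H.awake_succ hK (.inr (.inr hfin)), fun i => ?_, fun i => ?_, fun i => ?_,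
    fun i => ?_⟩ <;> rw [mind_succ H.awake, ht] <;> simp [upd, H.id, H.len]

theorem Sync.add (H : Sync E L s 0 t) (hK : ∀ i, (E.id i).length = K) (hτ : τ < L) :
    Sync E L s τ (t + τ) := by
  induction τ with
  | zero => exact H
  | succ τ ih => exact (ih (by omega)).succ hK hτ

theorem Sync.next_slot (H : Sync E L s 0 t) (hK : ∀ i, (E.id i).length = K) (hL : 0 < L)
    (hs : s < 4 * (K * K) + 3) : Sync E L (s + 1) 0 (t + L) := by
  have := (H.add hK (τ := L - 1) (by omega)).succ_slot hK (by omega) hs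
  rwa [add_assoc, Nat.sub_add_cancel hL] at this

theorem Sync.fin_succ (H : Sync E L s τ t) (hK : ∀ i, (E.id i).length = K)
    (hs : s < 4 * (K * K) + 3) : (mind E (t + 1) i).fin = (mind E t i).fin := by
  rw [mind_succ H.awake, Mem.tick_fin, upd, Mem.update_fin] <;> rw [H.slot, H.gather hK] <;> omega

/-! ### Scores -/

section Score

variable {n : ℕ} {g : Bool} {missing : ℕ → Option (ZMod n)} {x y : ℕ → ZMod n} {c : ZMod n}
  {b b' seen seen' : ℕ → Bool} {S S' : ℕ → ℕ} {L : ℕ}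

/-- A walker counts its failed moves, and adds `L` whenever it returns to node `c`. -/
structure Scores (x : ℕ → ZMod n) (c : ZMod n) (b seen : ℕ → Bool) (S : ℕ → ℕ) (L : ℕ) :
    Prop where
  score_one : S 1 = 0
  seen_one : seen 1 = false
  score_succ : ∀ τ, 1 ≤ τ → τ < L →
    S (τ + 1) = S τ + if b τ then 1 else if seen τ && decide (x τ = c) then L else 0
  seen_succ : ∀ τ, 1 ≤ τ → τ < L → seen (τ + 1) = (seen τ || decide (x τ = c))

/-- Each attempt is a success or a counted failure, until a return adds `L`. A return is a
successful step onto `c` after an earlier visit with fewer moves, so the two move counts differ by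
at least `n`, whence `n ≤ L`. Conversely, `r` moves lead to `c` and `n` more lead back to it.
Failures are counted one round late, so `S (τ + 1)` accounts for the first `τ` attempts. -/
theorem Scores.invariant (h : Scores x c b seen S L)
    (hx : ∀ τ < L, (x (τ + 1), b (τ + 1)) = attempt (missing τ) (x τ) g) {r : ℕ} (hr : 0 < r)
    (hrn : r ≤ n) (hc : c = x 0 + sgn n g * r) {τ : ℕ} (hτ : τ < L) :
    (seen (τ + 1) = true → ∃ d : ℕ, d ≤ moves b τ ∧ x 0 + sgn n g * d = c) ∧
    (n ≤ L ∧ L ≤ S (τ + 1) ∨ S (τ + 1) + moves b τ = τ) ∧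
    (r ≤ moves b τ → seen (τ + 1) = true) ∧ (r + n ≤ moves b τ → L ≤ S (τ + 1)) := by
  induction τ with
  | zero => simp [h.score_one, h.seen_one]; omega
  | succ τ ih =>
    obtain ⟨h1, h2, h3, h4⟩ := ih (by omega)
    have hS := h.score_succ (τ + 1) (by omega) hτ
    have hs := h.seen_succ (τ + 1) (by omega) hτ
    have hm := moves_succ b τ
    have hp := pos_eq_moves hx hτ.le
    have hle := moves_le b (τ + 1)
    by_cases hb : b (τ + 1) = true
    · rw [if_pos hb] at hS hm
      rw [add_zero] at hm
      rw [hm] at hp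
      rw [hS, hs, hm]
      refine ⟨fun h' => ?_, by omega, fun h' => by rw [h3 h', Bool.true_or],
        fun h' => (h4 h').trans (Nat.le_succ _)⟩
      rw [Bool.or_eq_true, decide_eq_true_eq] at h'
      rcases h' with h' | h'
      · exact h1 h'
      · exact ⟨_, le_rfl, hp.symm.trans h'⟩
    · rw [if_neg hb] at hS hm
      have hseen : r + 1 ≤ moves b (τ + 1) → seen (τ + 1) = true := fun h' => h3 (by omega)
      by_cases hxc : x (τ + 1) = c
      · rw [hxc] at hp
        rw [decide_eq_true hxc, Bool.and_true] at hS
        rw [decide_eq_true hxc, Bool.or_true] at hs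
        refine ⟨fun _ => ⟨_, le_rfl, hp.symm⟩, ?_, fun _ => hs, fun h' => ?_⟩
        · by_cases hsn : seen (τ + 1) = true
          · left
            rw [if_pos hsn] at hS
            obtain ⟨d, hd, hd'⟩ := h1 hsn
            have := add_sgn_mul_inj (hd'.trans hp) (by omega)
            omega
          · rw [if_neg hsn] at hS
            omega
        · rw [hS, if_pos (hseen (by omega))]
          omega
      · rw [decide_eq_false hxc, Bool.and_false, if_neg Bool.false_ne_true, add_zero] at hS
        rw [decide_eq_false hxc, Bool.or_false] at hs
        rw [hS, hs]
        refine ⟨fun h' => ?_, by omega, fun h' => ?_, fun h' => ?_⟩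
        · obtain ⟨d, hd, hd'⟩ := h1 h'
          exact ⟨d, by omega, hd'⟩
        · rcases eq_or_lt_of_le h' with h' | h'
          · exact absurd (by rw [hp, ← h', hc]) hxc
          · exact hseen h'
        · rcases eq_or_lt_of_le h' with h' | h'
          · exact absurd (by rw [hp, ← h', hc]; push_cast; simp) hxc
          · exact h4 (by omega)

/-- High scores certify that the ring is small. -/
theorem le_of_le_scores (hn : 3 ≤ n) (hL : 0 < L) (hxy : x 0 = y 0)
    (hx : ∀ τ < L, (x (τ + 1), b (τ + 1)) = attempt (missing τ) (x τ) g)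
    (hy : ∀ τ < L, (y (τ + 1), b' (τ + 1)) = attempt (missing τ) (y τ) !g)
    (h : Scores x c b seen S L) (h' : Scores y c b' seen' S' L)
    (hS : L ≤ S L + S' L) : n ≤ L := by
  obtain ⟨r, hr, hrn, hrc, -⟩ := exists_steps hn g (x 0) c
  obtain ⟨q, hq, hqn, hqc, -⟩ := exists_steps hn (!g) (y 0) c
  -- Without a return the failures add up to at least `L` in `L - 1` rounds, leaving at most `L - 2`
  -- successes. This is less than one per round, so `le_moves_add_moves` yields the bound on `n`.
  have h1 := (h.invariant hx hr hrn hrc (τ := L - 1) (by omega)).2.1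
  have h2 := (h'.invariant hy hq hqn hqc (τ := L - 1) (by omega)).2.1
  have h3 := le_moves_add_moves hxy hx hy (τ := L - 1) (by omega)
  rw [Nat.sub_add_cancel hL] at h1 h2
  omega

/-- The scores are high if the ring is small enough. -/
theorem le_scores (hn : 3 ≤ n) (hL : 0 < L)
    (hx : ∀ τ < L, (x (τ + 1), b (τ + 1)) = attempt (missing τ) (x τ) g)
    (hy : ∀ τ < L, (y (τ + 1), b' (τ + 1)) = attempt (missing τ) (y τ) !g)
    (h : Scores x c b seen S L) (h' : Scores y c b' seen' S' L)
    (hnL : 4 * n ≤ L) : L ≤ S L + S' L := by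
  obtain ⟨r, hr, hrn, hrc, -⟩ := exists_steps hn g (x 0) c
  obtain ⟨q, hq, hqn, hqc, -⟩ := exists_steps hn (!g) (y 0) c
  -- Without a return each walker makes fewer than `2 n` moves, so at least `2 (L - 1) - (4 n - 2) ≥
  -- L` attempts fail.
  have h1 := (h.invariant hx hr hrn hrc (τ := L - 1) (by omega)).2
  have h2 := (h'.invariant hy hq hqn hqc (τ := L - 1) (by omega)).2
  rw [Nat.sub_add_cancel hL] at h1 h2
  omega

end Score

/-! ### Slots in which agents that are alone move -/

section Chase

variable {n : ℕ} {E : Setting n} {t L s K : ℕ} {mv d : Fin 3 → Bool}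

theorem place_eq_of_crowd {t : ℕ} {i : Fin 3} (h : Awake E t) {p d : Bool}
    (hact : (upd E t i).act (heard E t i) =
      if (heard E t i).length == 0 && p then Mem.go d else .stay)
    (hp : p = false ∨ ∃ j, j ≠ i ∧ place E t j = place E t i) :
    place E (t + 1) i = place E t i := by
  refine place_of_stay h ?_
  rw [hact, if_neg]
  rw [Bool.and_eq_true, length_heard_eq_zero h]
  rintro ⟨h1, h2⟩
  rcases hp with hp | ⟨j, hj, hp⟩
  · rw [h2] at hp; exact Bool.noConfusion hp
  · exact h1 j hj hp

/-- Agents that are together stay together. -/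
theorem together_of_chase (H : Sync E L s 0 t) (hK : ∀ i, (E.id i).length = K) {τ : ℕ} (hτ : τ < L)
    (hact : ∀ τ < L, ∀ i, (upd E (t + τ) i).act (heard E (t + τ) i) =
      if (heard E (t + τ) i).length == 0 && mv i then Mem.go (d i) else .stay) {i j : Fin 3}
    (hij : i ≠ j) (hp : place E (t + τ) i = place E (t + τ) j) :
    place E (t + (τ + 1)) i = place E (t + (τ + 1)) j := by
  have hA := (H.add hK hτ).awake
  rw [← add_assoc, place_eq_of_crowd hA (hact τ hτ i) (.inr ⟨j, hij.symm, hp.symm⟩),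
    place_eq_of_crowd hA (hact τ hτ j) (.inr ⟨i, hij, hp⟩), hp]

theorem exists_together_of_chase (H : Sync E L s 0 t) (hK : ∀ i, (E.id i).length = K) (hn : 3 ≤ n)
    (hL : 2 * n ≤ L)
    (hact : ∀ τ < L, ∀ i, (upd E (t + τ) i).act (heard E (t + τ) i) =
      if (heard E (t + τ) i).length == 0 && mv i then Mem.go (d i) else .stay)
    {a b c : Fin 3} (hab : a ≠ b) (hac : a ≠ c) (hbc : b ≠ c) (ha : mv a = true) (hb : mv b = true)
    (hc : mv c = false) (hd : clockwise E a (d a) = clockwise E b (d b)) :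
    ∃ i j, i ≠ j ∧ place E (t + L) i = place E (t + L) j := by
  refine exists_meet_of_chase (pos := fun τ => place E (t + τ))
    (missing := fun τ => E.missing (t + τ)) hn hab hac hbc (g := clockwise E a (d a)) hL
    (fun τ hτ hne => ?_) (fun τ hτ i j hij => together_of_chase H hK hτ hact hij)
  have hA := (H.add hK hτ).awake
  have hgo : ∀ i, mv i = true → place E (t + τ + 1) i =
      (attempt (E.missing (t + τ)) (place E (t + τ) i) (clockwise E i (d i))).1 := by
    intro i hi
    rw [← place_of_go hA]
    rw [hact τ hτ, if_pos]
    rw [hi, Bool.and_true, length_heard_eq_zero hA]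
    exact fun j hj => hne j i hj
  refine ⟨hgo a ha, ?_, place_eq_of_crowd hA (hact τ hτ c) (.inl hc)⟩
  rw [hd]
  exact hgo b hb

end Chase

/-! ### The first slots of a phase -/

section Gather

variable {n : ℕ} {E : Setting n} {t L s K : ℕ}

theorem exists_getD_ne {l l' : List Bool} (hl : l.length = K) (hl' : l'.length = K) (h : l ≠ l') :
    ∃ p < K, l.getD p false ≠ l'.getD p false := by
  by_contra! hall
  refine h (List.ext_getElem (hl.trans hl'.symm) fun p h1 h2 => ?_)
  have := hall p (hl ▸ h1)
  rwa [List.getD_eq_getElem _ _ h1, List.getD_eq_getElem _ _ h2] at this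

/-- Among three distinct identifiers there are two that agree at a position where the third one
differs from them. -/
theorem exists_odd_one (hK : ∀ i, (E.id i).length = K) (hinj : Function.Injective E.id) :
    ∃ a b c : Fin 3, a ≠ b ∧ a ≠ c ∧ b ≠ c ∧ ∃ p < K,
      (E.id b).getD p false = (E.id a).getD p false ∧
      (E.id c).getD p false = !(E.id a).getD p false := by
  -- Where agents 0 and 1 differ, agent 2 must agree with exactly one of them.
  obtain ⟨p, hp, h⟩ := exists_getD_ne (hK 0) (hK 1) (hinj.ne (by decide))
  by_cases h2 : (E.id 2).getD p false = (E.id 0).getD p false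
  · exact ⟨0, 2, 1, by decide, by decide, by decide, p, hp, h2, by
      cases h3 : (E.id 0).getD p false <;> cases h4 : (E.id 1).getD p false <;> simp_all⟩
  · exact ⟨1, 2, 0, by decide, by decide, by decide, p, hp, by
      cases h3 : (E.id 0).getD p false <;> cases h4 : (E.id 1).getD p false <;>
      cases h5 : (E.id 2).getD p false <;> simp_all, by
      cases h3 : (E.id 0).getD p false <;> cases h4 : (E.id 1).getD p false <;> simp_all⟩

theorem moveBit_eq {id : List Bool} {p q w v : ℕ} (hq : q < id.length) (hw : w < 2) (hv : v < 2) :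
    Mem.moveBit id (4 * (id.length * p + q) + 2 * w + v) = id.getD p false := by
  rw [Mem.moveBit]
  congr 1
  rw [show (4 * (id.length * p + q) + 2 * w + v) / 4 = id.length * p + q by omega,
    Nat.mul_add_div (by omega), Nat.div_eq_of_lt hq, add_zero]

theorem dirBit_eq {id : List Bool} {p q w v : ℕ} (hq : q < id.length) (hw : w < 2) (hv : v < 2) :
    Mem.dirBit id (4 * (id.length * p + q) + 2 * w + v) = id.getD q false := by
  rw [Mem.dirBit]
  congr 1
  rw [show (4 * (id.length * p + q) + 2 * w + v) / 4 = id.length * p + q by omega,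
    Nat.mul_add_mod, Nat.mod_eq_of_lt hq]

/-- In some slot two agents move in the same direction while the third one stands still. -/
theorem exists_good_slot (hK : ∀ i, (E.id i).length = K) (hinj : Function.Injective E.id) :
    ∃ s < 4 * (K * K), ∃ a b c : Fin 3, a ≠ b ∧ a ≠ c ∧ b ≠ c ∧
      Mem.seeks (E.id a) s = true ∧ Mem.seeks (E.id b) s = true ∧ Mem.seeks (E.id c) s = false ∧
      clockwise E a (Mem.seekDir (E.id a) s) = clockwise E b (Mem.seekDir (E.id b) s) := by
  obtain ⟨a, b, c, hab, hac, hbc, p, hp, hb, hc⟩ := exists_odd_one hK hinj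
  obtain ⟨q, hq, hne⟩ := exists_getD_ne (hK a) (hK b) (hinj.ne hab)
  -- The parity `v` selects which value of bit `p` moves: here the value shared by `a` and `b`.
  obtain ⟨v, hv, hv'⟩ : ∃ v < 2, (v == 0) = !(E.id a).getD p false := by
    cases (E.id a).getD p false
    · exact ⟨0, by omega, rfl⟩
    · exact ⟨1, by omega, rfl⟩
  -- With equal orientations both go right (`w = 0`). With opposite ones they follow their bits `q`,
  -- which differ, and so go the same way.
  obtain ⟨w, hw, hw'⟩ : ∃ w < 2, (w == 0) = (E.rightIsCW a == E.rightIsCW b) := by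
    cases (E.rightIsCW a == E.rightIsCW b)
    · exact ⟨1, by omega, rfl⟩
    · exact ⟨0, by omega, rfl⟩
  have hmb : ∀ i, Mem.moveBit (E.id i) (4 * (K * p + q) + 2 * w + v) = (E.id i).getD p false := by
    intro i
    have := moveBit_eq (id := E.id i) (p := p) (hq.trans_eq (hK i).symm) hw hv
    rwa [hK] at this
  have hdb : ∀ i, Mem.dirBit (E.id i) (4 * (K * p + q) + 2 * w + v) = (E.id i).getD q false := by
    intro i
    have := dirBit_eq (id := E.id i) (p := p) (hq.trans_eq (hK i).symm) hw hv
    rwa [hK] at this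
  have h2 : (4 * (K * p + q) + 2 * w + v) % 2 = v := by omega
  have h4 : (4 * (K * p + q) + 2 * w + v) / 2 % 2 = w := by omega
  refine ⟨4 * (K * p + q) + 2 * w + v, ?_, a, b, c, hab, hac, hbc, ?_, ?_, ?_, ?_⟩
  · have : K * p + q + 1 ≤ K * K := by
      calc K * p + q + 1 ≤ K * p + K := by omega
        _ = K * (p + 1) := by ring
        _ ≤ K * K := Nat.mul_le_mul_left _ hp
    omega
  · rw [Mem.seeks, hmb, h2, hv']; cases (E.id a).getD p false <;> rfl
  · rw [Mem.seeks, hmb, h2, hv', hb]; cases (E.id a).getD p false <;> rfl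
  · rw [Mem.seeks, hmb, h2, hv', hc]; cases (E.id a).getD p false <;> rfl
  · rw [Mem.seekDir, Mem.seekDir, hdb, hdb, h4, hw', clockwise, clockwise]
    revert hne
    cases E.rightIsCW a <;> cases E.rightIsCW b <;> cases (E.id a).getD q false <;>
      cases (E.id b).getD q false <;> simp

theorem act_of_gather (H : Sync E L s 0 t) (hK : ∀ i, (E.id i).length = K) (hs : s < 4 * (K * K))
    {τ : ℕ} (hτ : τ < L) (i : Fin 3) : (upd E (t + τ) i).act (heard E (t + τ) i) =
      if (heard E (t + τ) i).length == 0 && Mem.seeks (E.id i) s then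
        Mem.go (Mem.seekDir (E.id i) s) else .stay := by
  have H' := H.add hK hτ
  rw [Mem.act, if_pos]
  · simp [upd, H'.id, H'.slot]
  · simpa [upd, H'.slot, H'.gather hK] using hs

/-- In the first slots of a long enough phase, two agents meet. -/
theorem exists_together_of_gather (H : Sync E L 0 0 t) (hK : ∀ i, (E.id i).length = K)
    (hinj : Function.Injective E.id) (hn : 3 ≤ n) (hL : 2 * n ≤ L) :
    ∃ i j, i ≠ j ∧ place E (t + 4 * (K * K) * L) i = place E (t + 4 * (K * K) * L) j := by
  have hS : ∀ s ≤ 4 * (K * K), Sync E L s 0 (t + s * L) := by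
    intro s
    induction s with
    | zero => intro; simpa using H
    | succ s ih =>
      intro hs
      have := (ih (by omega)).next_slot hK (by omega) (by omega)
      rwa [add_assoc, ← Nat.succ_mul] at this
  obtain ⟨s, hs, a, b, c, hab, hac, hbc, ha, hb, hc, hd⟩ := exists_good_slot hK hinj
  obtain ⟨i, j, hij, hp⟩ := exists_together_of_chase (hS s hs.le) hK hn hL
    (fun τ hτ => act_of_gather (hS s hs.le) hK hs hτ) hab hac hbc ha hb hc hd
  refine ⟨i, j, hij, ?_⟩
  rw [add_assoc, ← Nat.succ_mul] at hp
  have key : ∀ r, s + 1 ≤ r → r ≤ 4 * (K * K) →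
      place E (t + r * L) i = place E (t + r * L) j := by
    intro r hr
    induction r, hr using Nat.le_induction with
    | base => exact fun _ => hp
    | succ r hr ih =>
      intro hr'
      have h0 := ih (by omega)
      have hslot : ∀ τ ≤ L, place E (t + r * L + τ) i = place E (t + r * L + τ) j := by
        intro τ
        induction τ with
        | zero => exact fun _ => h0
        | succ τ ih =>
          exact fun hτ => together_of_chase (hS r (by omega)) hK hτ
            (fun τ hτ => act_of_gather (hS r (by omega)) hK hr' hτ) hij (ih (by omega))
      have := hslot L le_rfl
      rwa [add_assoc, ← Nat.succ_mul] at this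
  exact key _ hs le_rfl

end Gather

section Slots

variable {n : ℕ} {E : Setting n} {t L s τ K : ℕ} {i : Fin 3}

/-! ### What the agents compute in the last four slots of a phase -/

theorem Sync.upd_measure_zero (H : Sync E L (4 * (K * K)) 0 t) (hK : ∀ i, (E.id i).length = K) :
    upd E t i = (role E true t i (mind E t i)).clear := by
  rw [upd, Mem.update, if_neg, if_pos, if_pos]
  · rfl
  · simp [H.timer]
  · simp [H.slot, H.gather hK]
  · simp [H.slot, H.gather hK]

theorem Sync.upd_measure (H : Sync E L (4 * (K * K)) τ t) (hK : ∀ i, (E.id i).length = K)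
    (hτ : τ ≠ 0) : upd E t i = (mind E t i).count (failed E t i) (heard E t i) := by
  rw [upd, Mem.update, if_neg, if_pos, if_neg]
  · simpa [H.timer] using hτ
  · simp [H.slot, H.gather hK]
  · simp [H.slot, H.gather hK]

theorem Sync.act_measure (H : Sync E L (4 * (K * K)) τ t) (hK : ∀ i, (E.id i).length = K) :
    (upd E t i).act (heard E t i) =
      if (upd E t i).walks then Mem.go (upd E t i).dir else .stay := by
  rw [Mem.act, if_neg, if_pos]
  · simp [upd, H.slot, H.gather hK]
  · simp [upd, H.slot, H.gather hK]

theorem Sync.upd_chase (H : Sync E L (4 * (K * K) + 1) τ t) (hK : ∀ i, (E.id i).length = K) :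
    upd E t i = (mind E t i).merge (heard E t i) := by
  rw [upd, Mem.update, if_neg, if_neg, if_pos]
  all_goals simp [H.slot, H.gather hK]

theorem Sync.act_chase (H : Sync E L (4 * (K * K) + 1) τ t) (hK : ∀ i, (E.id i).length = K) :
    (upd E t i).act (heard E t i) =
      if (heard E t i).length == 0 && (mind E t i).walks then
        Mem.go ((mind E t i).dir == (mind E t i).lead) else .stay := by
  rw [Mem.act, if_neg, if_neg, if_pos]
  · simp [H.upd_chase hK, Mem.merge]
  all_goals simp [upd, H.slot, H.gather hK]

theorem Sync.upd_split (H : Sync E L s τ t) (hK : ∀ i, (E.id i).length = K)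
    (hs : s = 4 * (K * K) + 2 ∨ s = 4 * (K * K) + 3) :
    upd E t i =
      let m := if τ = 0 then role E false t i ((mind E t i).merge (heard E t i))
        else (mind E t i).merge (heard E t i)
      if s = 4 * (K * K) + 2 then m else m.decideFin (heard E t i) := by
  rw [upd, Mem.update, if_neg, if_neg, if_neg]
  · simp only [beq_iff_eq, H.slot, H.gather hK, H.timer]
    rfl
  all_goals
    simp only [beq_iff_eq, decide_eq_true_eq, H.slot, H.gather hK]
    omega

theorem Sync.act_split (H : Sync E L s τ t) (hK : ∀ i, (E.id i).length = K)
    (hs : s = 4 * (K * K) + 2 ∨ s = 4 * (K * K) + 3 ∧ τ + 1 ≠ L) :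
    (upd E t i).act (heard E t i) =
      if (upd E t i).walks && (τ == 0 || (heard E t i).length == 0) then Mem.go (upd E t i).dir
      else .stay := by
  rw [Mem.act, if_neg, if_neg, if_neg, if_neg]
  · simp [upd, H.timer]
  all_goals
    simp only [upd, Bool.and_eq_true, beq_iff_eq, decide_eq_true_eq, Mem.update_slot,
      Mem.update_gather, Mem.update_timer, Mem.update_len, H.slot, H.gather hK, H.timer, H.len]
    omega

theorem Sync.upd_score (H : Sync E L s τ t) (hK : ∀ i, (E.id i).length = K)
    (hs : 4 * (K * K) < s) (hs' : s ≤ 4 * (K * K) + 3) :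
    (upd E t i).scoreA = ((mind E t i).merge (heard E t i)).scoreA ∧
    (upd E t i).scoreB = ((mind E t i).merge (heard E t i)).scoreB := by
  rcases (by omega : s = 4 * (K * K) + 1 ∨ s = 4 * (K * K) + 2 ∨ s = 4 * (K * K) + 3) with rfl | hs
  · rw [H.upd_chase hK]; exact ⟨rfl, rfl⟩
  · rw [H.upd_split hK hs]
    dsimp only
    split_ifs <;> exact ⟨rfl, rfl⟩

/-! ### Spreading the scores -/

theorem Sync.scoreA_succ_le (H : Sync E L s τ t) (hK : ∀ i, (E.id i).length = K)
    (hs : 4 * (K * K) < s) (hs' : s ≤ 4 * (K * K) + 3) {c : ℕ} :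
    (mind E (t + 1) i).scoreA ≤ c ↔
      ∀ j, place E t j = place E t i → (mind E t j).scoreA ≤ c := by
  rw [mind_succ H.awake, Mem.tick_scoreA, (H.upd_score hK hs hs').1, merge_scoreA_le H.awake]

theorem Sync.scoreB_succ_le (H : Sync E L s τ t) (hK : ∀ i, (E.id i).length = K)
    (hs : 4 * (K * K) < s) (hs' : s ≤ 4 * (K * K) + 3) {c : ℕ} :
    (mind E (t + 1) i).scoreB ≤ c ↔
      ∀ j, place E t j = place E t i → (mind E t j).scoreB ≤ c := by
  rw [mind_succ H.awake, Mem.tick_scoreB, (H.upd_score hK hs hs').2, merge_scoreB_le H.awake]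

variable {α β : ℕ}

/-- Merging takes maxima, so it creates no score beyond those measured. Keeping two components makes
hearing the same score repeatedly harmless. -/
theorem scores_le (H : Sync E L s 0 t) (hK : ∀ i, (E.id i).length = K) (hs : 4 * (K * K) < s)
    (hs' : s ≤ 4 * (K * K) + 3)
    (h : ∀ i, (mind E t i).scoreA ≤ α ∧ (mind E t i).scoreB ≤ β) (hτ : τ ≤ L) (i : Fin 3) :
    (mind E (t + τ) i).scoreA ≤ α ∧ (mind E (t + τ) i).scoreB ≤ β := by
  induction τ generalizing i with
  | zero => exact h i
  | succ τ ih =>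
    have H' := H.add hK hτ
    exact ⟨(H'.scoreA_succ_le hK hs hs').2 fun j _ => (ih (by omega) j).1,
      (H'.scoreB_succ_le hK hs hs').2 fun j _ => (ih (by omega) j).2⟩

theorem le_scores_later (H : Sync E L s 0 t) (hK : ∀ i, (E.id i).length = K) (hs : 4 * (K * K) < s)
    (hs' : s ≤ 4 * (K * K) + 3) {σ : ℕ} (hσ : σ ≤ τ) (hτ : τ ≤ L) (i : Fin 3) :
    (mind E (t + σ) i).scoreA ≤ (mind E (t + τ) i).scoreA ∧
    (mind E (t + σ) i).scoreB ≤ (mind E (t + τ) i).scoreB := by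
  induction τ, hσ using Nat.le_induction with
  | base => exact ⟨le_rfl, le_rfl⟩
  | succ τ hσ ih =>
    have H' := H.add hK hτ
    have ih := ih (by omega)
    exact ⟨ih.1.trans ((H'.scoreA_succ_le hK hs hs').1 le_rfl i rfl),
      ih.2.trans ((H'.scoreB_succ_le hK hs hs').1 le_rfl i rfl)⟩

/-! ### The slot in which two walkers chase the third agent -/

theorem chase_const (H : Sync E L (4 * (K * K) + 1) 0 t) (hK : ∀ i, (E.id i).length = K)
    (hτ : τ ≤ L) : (mind E (t + τ) i).walks = (mind E t i).walks ∧
      (mind E (t + τ) i).dir = (mind E t i).dir ∧ (mind E (t + τ) i).lead = (mind E t i).lead := by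
  induction τ with
  | zero => exact ⟨rfl, rfl, rfl⟩
  | succ τ ih =>
    have H' := H.add hK hτ
    rw [← add_assoc, mind_succ H'.awake, H'.upd_chase hK]
    simpa [Mem.merge] using ih (by omega)

theorem exists_together_of_roles (H : Sync E L (4 * (K * K) + 1) 0 t)
    (hK : ∀ i, (E.id i).length = K) (hn : 3 ≤ n) (hL : 2 * n ≤ L) {a b c : Fin 3} (hab : a ≠ b)
    (hac : a ≠ c) (hbc : b ≠ c) (hR : Roles E (mind E t) a b c) :
    ∃ i j, i ≠ j ∧ place E (t + L) i = place E (t + L) j := by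
  refine exists_together_of_chase (mv := fun i => (mind E t i).walks)
    (d := fun i => (mind E t i).dir == (mind E t i).lead) H hK hn hL (fun τ hτ i => ?_) hab hac hbc
    hR.walks_fst hR.walks_snd hR.walks_thd ?_
  · obtain ⟨h1, h2, h3⟩ := chase_const (i := i) H hK hτ.le
    rw [(H.add hK hτ).act_chase hK, h1, h2, h3]
  · have := hR.opposite
    rw [hR.lead_fst, hR.lead_snd]
    unfold clockwise at *
    revert this
    cases (mind E t a).dir <;> cases (mind E t b).dir <;> cases E.rightIsCW a <;>
      cases E.rightIsCW b <;> simp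

/-! ### The slots in which two agents split to reach the third one -/

theorem split_const (H : Sync E L s 0 t) (hK : ∀ i, (E.id i).length = K)
    (hs : s = 4 * (K * K) + 2 ∨ s = 4 * (K * K) + 3) (hτ : τ < L) :
    (upd E (t + τ) i).walks =
      (role E false t i ((mind E t i).merge (heard E t i))).walks ∧
    (upd E (t + τ) i).dir = (role E false t i ((mind E t i).merge (heard E t i))).dir := by
  induction τ with
  | zero =>
    rw [add_zero, H.upd_split hK hs]
    dsimp only
    rw [if_pos rfl]
    split_ifs <;> exact ⟨rfl, rfl⟩
  | succ τ ih =>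
    have H' := H.add hK (τ := τ) (by omega)
    have h1 : (upd E (t + (τ + 1)) i).walks = (upd E (t + τ) i).walks ∧
        (upd E (t + (τ + 1)) i).dir = (upd E (t + τ) i).dir := by
      rw [(H.add hK hτ).upd_split hK hs]
      rw [← add_assoc, ← Mem.tick_walks (m := upd E (t + τ) i),
        ← Mem.tick_dir (m := upd E (t + τ) i), ← mind_succ H'.awake]
      dsimp only
      rw [if_neg (Nat.succ_ne_zero τ)]
      split_ifs <;> exact ⟨rfl, rfl⟩
    rw [h1.1, h1.2]
    exact ih (by omega)

theorem place_of_split (H : Sync E L s 0 t) (hK : ∀ i, (E.id i).length = K)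
    (hs : s = 4 * (K * K) + 2 ∨ s = 4 * (K * K) + 3 ∧ τ + 1 ≠ L) (hτ : τ < L) {w : Mem}
    (hw : w = role E false t i ((mind E t i).merge (heard E t i))) :
    (w.walks = true → (τ = 0 ∨ ∀ j, j ≠ i → place E (t + τ) j ≠ place E (t + τ) i) →
      place E (t + (τ + 1)) i =
        (attempt (E.missing (t + τ)) (place E (t + τ) i) (clockwise E i w.dir)).1) ∧
    ((w.walks = false ∨ τ ≠ 0 ∧ ∃ j, j ≠ i ∧ place E (t + τ) j = place E (t + τ) i) →
      place E (t + (τ + 1)) i = place E (t + τ) i) := by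
  have H' := H.add hK hτ
  have hact := H'.act_split (i := i) hK hs
  have hc := split_const (i := i) H hK (by omega) hτ
  rw [hc.1, hc.2, ← hw] at hact
  have hz := length_heard_eq_zero (i := i) H'.awake
  constructor
  · intro h1 h2
    rw [h1, Bool.true_and, if_pos] at hact
    · rw [← add_assoc, ← place_of_go H'.awake hact]
    · rwa [Bool.or_eq_true, beq_iff_eq, hz]
  · intro h
    rw [if_neg] at hact
    · exact place_of_stay H'.awake hact
    · rw [Bool.and_eq_true, Bool.or_eq_true, hz, beq_iff_eq]
      rintro ⟨h1, h2⟩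
      rcases h with h | ⟨h, j, hj, hp⟩
      · exact Bool.false_ne_true (h.symm.trans h1)
      · exact h2.elim h fun h2 => h2 j hj hp

/-- If two agents are together at the start, then at the end one of them is with the third one. -/
theorem reach_of_split (H : Sync E L s 0 t) (hK : ∀ i, (E.id i).length = K)
    (hinj : Function.Injective E.id) (hn : 3 ≤ n) {ℓ : ℕ}
    (hs : s = 4 * (K * K) + 2 ∧ ℓ ≤ L ∨ s = 4 * (K * K) + 3 ∧ ℓ < L) (hℓ : n ≤ ℓ + 1)
    {i j k : Fin 3} (hij : i ≠ j) (hik : i ≠ k) (hjk : j ≠ k)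
    (hp : place E t i = place E t j) :
    place E (t + ℓ) i = place E (t + ℓ) k ∨ place E (t + ℓ) j = place E (t + ℓ) k := by
  by_cases hk : place E t k = place E t i
  -- When all three are together no walker is chosen, so they simply stay together.
  · have hall : ∀ x, place E t x = place E t i := by
      intro x
      rcases cover hij hik hjk x with rfl | rfl | rfl
      exacts [rfl, hp.symm, hk]
    have key : ∀ τ ≤ ℓ, ∀ x, place E (t + τ) x = place E t x := by
      intro τ
      induction τ with
      | zero => exact fun _ _ => rfl
      | succ τ ih =>
        intro hτ x
        rw [(place_of_split H hK (by omega) (by omega) rfl).2 (.inl ?_), ih (by omega)]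
        exact role_of_together H.awake (fun x y => (hall x).trans (hall y).symm) _
    left
    rw [key ℓ le_rfl, key ℓ le_rfl, hk]
  · wlog hlt : said E t i < said E t j generalizing i j with hwlog
    · exact (hwlog hij.symm hjk hik hp.symm (hp ▸ hk)
        (lt_of_le_of_ne (not_lt.1 hlt) (H.said_ne hinj hij.symm))).symm
    have hR := roles_of_pair H.awake hij hik hjk hp hk hlt false
      (fun x => (mind E t x).merge (heard E t x))
    refine meet_of_split (pos := fun τ => place E (t + τ)) (missing := fun τ => E.missing (t + τ))
      (g := clockwise E i (role E false t i ((mind E t i).merge (heard E t i))).dir)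
      hn hij hik hjk (cover hij hik hjk) (L := ℓ) hp hk
      (fun τ hτ => ?_) (fun τ hτ x d hx hm => ?_) (fun τ hτ x hx h0 hm => ?_) hℓ le_rfl
    · exact (place_of_split H hK (by omega) (by omega) rfl).2 (.inl hR.walks_thd)
    · rcases hx with ⟨rfl, rfl⟩ | ⟨rfl, rfl⟩
      · exact (place_of_split H hK (by omega) (by omega) rfl).1 hR.walks_fst hm
      · rw [← hR.opposite]
        exact (place_of_split H hK (by omega) (by omega) rfl).1 hR.walks_snd hm
    · exact (place_of_split H hK (by omega) (by omega) rfl).2 (.inr ⟨h0, hm⟩)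

/-! ### Termination -/

/-- The scores at time `t + 1` are those merged in this very round, and the decision rests on them.
-/
theorem upd_fin_zero (H : Sync E L (4 * (K * K) + 3) 0 t) (hK : ∀ i, (E.id i).length = K)
    (hfin : ∀ i, (mind E t i).fin = false) : (upd E t i).fin = true ↔
      (∃ j, j ≠ i ∧ place E t j = place E t i) ∧
      L ≤ (mind E (t + 1) i).scoreA + (mind E (t + 1) i).scoreB := by
  have hA := H.awake
  rw [mind_succ hA, Mem.tick_scoreA, Mem.tick_scoreB, H.upd_split hK (.inr rfl)]
  have h1 : ((heard E t i).any fun x => (Mem.view x).1.fin) = false := by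
    rw [Bool.eq_false_iff, Ne, any_heard hA]
    rintro ⟨j, -, -, h⟩
    rw [view_said, hfin] at h
    exact Bool.false_ne_true h
  have h2 := length_heard_eq_zero (i := i) hA
  rw [beq_iff_eq] at h2
  have h3 : (∃ j, j ≠ i ∧ place E t j = place E t i) ↔ (heard E t i).length ≠ 0 := by
    rw [Ne, h2]; push Not; rfl
  rw [h3]
  simp [role, Mem.assign, Mem.merge, Mem.decideFin, h1, hfin, H.timer, H.len]

theorem upd_fin_succ (H : Sync E L (4 * (K * K) + 3) τ t) (hK : ∀ i, (E.id i).length = K)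
    (hτ : τ ≠ 0) : (upd E t i).fin = true ↔
      ∃ j, place E t j = place E t i ∧ (mind E t j).fin = true := by
  have hA := H.awake
  rw [H.upd_split hK (.inr rfl)]
  have h1 := any_heard (i := i) (p := fun x => (Mem.view x).1.fin) hA
  simp only [view_said] at h1
  simp only [if_neg hτ, Mem.merge, Mem.decideFin, H.timer]
  simp only [show 4 * (K * K) + 3 ≠ 4 * (K * K) + 2 by omega, if_false, Bool.or_eq_true, h1,
    Bool.and_eq_true, beq_iff_eq, hτ, false_and, or_false]
  constructor
  · rintro (h | ⟨j, -, h⟩)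
    · exact ⟨i, rfl, h⟩
    · exact ⟨j, h⟩
  · rintro ⟨j, h⟩
    by_cases hj : j = i
    · exact .inl (hj ▸ h.2)
    · exact .inr ⟨j, hj, h⟩

/-- In the last slot of a phase, two agents that know high scores make all agents terminate. -/
theorem inactive_of_high (H : Sync E L (4 * (K * K) + 3) 0 t) (hK : ∀ i, (E.id i).length = K)
    (hinj : Function.Injective E.id) (hn : 3 ≤ n) (hL : n ≤ L)
    (hfin : ∀ i, (mind E t i).fin = false) {i j : Fin 3} (hij : i ≠ j)
    (hp : place E t i = place E t j)
    (hi : L ≤ (mind E (t + 1) i).scoreA + (mind E (t + 1) i).scoreB) :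
    ∀ x, (conf E (t + L)).active x = false := by
  -- Agents at one node merge the same scores, so the partner takes the same decision; then
  -- whichever of the two reaches the third agent carries it.
  have hj : L ≤ (mind E (t + 1) j).scoreA + (mind E (t + 1) j).scoreB := by
    refine hi.trans (Nat.add_le_add ?_ ?_)
    · rw [H.scoreA_succ_le hK (by omega) (by omega), hp]
      exact (H.scoreA_succ_le hK (by omega) (by omega)).1 le_rfl
    · rw [H.scoreB_succ_le hK (by omega) (by omega), hp]
      exact (H.scoreB_succ_le hK (by omega) (by omega)).1 le_rfl
  have h1 : ∀ x, x = i ∨ x = j → (mind E (t + 1) x).fin = true := by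
    rintro x (rfl | rfl) <;> rw [mind_succ H.awake, Mem.tick_fin, upd_fin_zero H hK hfin]
    · exact ⟨⟨j, hij.symm, hp.symm⟩, hi⟩
    · exact ⟨⟨i, hij, hp⟩, hj⟩
  have h2 : ∀ τ, τ + 1 < L → ∀ x, x = i ∨ x = j → (mind E (t + (τ + 1)) x).fin = true := by
    intro τ
    induction τ with
    | zero => exact fun _ => h1
    | succ τ ih =>
      intro hτ x hx
      have H' := H.add hK (τ := τ + 1) (by omega)
      rw [← add_assoc t, mind_succ H'.awake, Mem.tick_fin, upd_fin_succ H' hK (by omega)]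
      exact ⟨x, rfl, ih (by omega) x hx⟩
  obtain ⟨k, hik, hjk, hcov⟩ := exists_third hij
  have H' := H.add hK (τ := L - 1) (by omega)
  have h3 : ∀ x, x = i ∨ x = j → (mind E (t + (L - 1)) x).fin = true := by
    have := h2 (L - 2) (by omega)
    rwa [show L - 2 + 1 = L - 1 by omega] at this
  -- After `L - 1 ≥ n - 1` rounds the third agent has company, and it learns the decision just in
  -- time for the last round.
  have h4 : ∀ x, (upd E (t + (L - 1)) x).fin = true := by
    intro x
    rw [upd_fin_succ H' hK (by omega)]
    rcases hcov x with rfl | rfl | rfl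
    · exact ⟨x, rfl, h3 x (.inl rfl)⟩
    · exact ⟨x, rfl, h3 x (.inr rfl)⟩
    · rcases reach_of_split H hK hinj hn (ℓ := L - 1) (.inr ⟨rfl, by omega⟩) (by omega) hij hik hjk
        hp with h | h
      · exact ⟨i, h, h3 i (.inl rfl)⟩
      · exact ⟨j, h, h3 j (.inr rfl)⟩
  intro x
  rw [show t + L = t + (L - 1) + 1 by omega, active_succ H'.awake, decide_eq_false_iff_not,
    not_not, Mem.act, if_neg, if_neg, if_neg, if_pos]
  all_goals
    simp only [h4, Bool.and_eq_true, beq_iff_eq, decide_eq_true_eq, and_true]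
    simp only [upd, Mem.update_slot, Mem.update_gather, Mem.update_timer, Mem.update_len, H'.slot,
      H'.gather hK, H'.timer, H'.len, true_and]
    omega

/-- Otherwise the next phase begins. -/
theorem next_phase (H : Sync E L (4 * (K * K) + 3) 0 t) (hK : ∀ i, (E.id i).length = K)
    (hL : 2 ≤ L) (hfin : ∀ i, (mind E t i).fin = false)
    (hno : ∀ i j, i ≠ j → place E t i = place E t j →
      (mind E (t + 1) i).scoreA + (mind E (t + 1) i).scoreB < L) :
    Sync E (2 * L) 0 0 (t + L) ∧ ∀ i, (mind E (t + L) i).fin = false := by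
  have h : ∀ τ < L, ∀ i, (upd E (t + τ) i).fin = false := by
    intro τ
    induction τ with
    | zero =>
      intro _ i
      rw [Bool.eq_false_iff, add_zero, Ne, upd_fin_zero H hK hfin]
      rintro ⟨⟨j, hj, hp⟩, hle⟩
      exact absurd (hno i j hj.symm hp.symm) (by omega)
    | succ τ ih =>
      intro hτ i
      rw [Bool.eq_false_iff, Ne, upd_fin_succ (H.add hK hτ) hK (by omega)]
      rintro ⟨j, -, hj⟩
      rw [← add_assoc, mind_succ (H.add hK (by omega)).awake, Mem.tick_fin, ih (by omega)] at hj
      exact Bool.false_ne_true hj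
  have H' := H.add hK (τ := L - 1) (by omega)
  have h' := h (L - 1) (by omega)
  rw [show t + L = t + (L - 1) + 1 by omega]
  refine ⟨H'.succ_phase hK (by omega) rfl h', fun i => ?_⟩
  rw [mind_succ H'.awake, Mem.tick_fin, h']

end Slots

section Measure

variable {n : ℕ} {E : Setting n} {t L s τ K : ℕ} {i : Fin 3}

/-! ### The slot in which two walkers measure the ring -/

theorem measure_const (H : Sync E L (4 * (K * K)) 0 t) (hK : ∀ i, (E.id i).length = K)
    (hτ : τ < L) : (upd E (t + τ) i).walks = (role E true t i (mind E t i)).walks ∧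
      (upd E (t + τ) i).dir = (role E true t i (mind E t i)).dir ∧
      (upd E (t + τ) i).lead = (role E true t i (mind E t i)).lead := by
  induction τ with
  | zero =>
    rw [add_zero, H.upd_measure_zero hK]
    exact ⟨rfl, rfl, rfl⟩
  | succ τ ih =>
    rw [(H.add hK hτ).upd_measure hK (Nat.succ_ne_zero τ), ← add_assoc,
      mind_succ (H.add hK (by omega)).awake]
    simpa [Mem.count] using ih (by omega)

theorem measure_const_succ (H : Sync E L (4 * (K * K)) 0 t) (hK : ∀ i, (E.id i).length = K)
    (hτ : τ < L) : (mind E (t + (τ + 1)) i).walks = (role E true t i (mind E t i)).walks ∧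
      (mind E (t + (τ + 1)) i).dir = (role E true t i (mind E t i)).dir ∧
      (mind E (t + (τ + 1)) i).lead = (role E true t i (mind E t i)).lead := by
  rw [← add_assoc, mind_succ (H.add hK hτ).awake]
  simpa using measure_const H hK hτ

/-- An agent that is not the leading walker has no score of the leading walker, and so on. -/
theorem measure_zero (H : Sync E L (4 * (K * K)) 0 t) (hK : ∀ i, (E.id i).length = K)
    (hτ : τ < L) :
    (((role E true t i (mind E t i)).walks = false ∨ (role E true t i (mind E t i)).lead = false) →
      (mind E (t + (τ + 1)) i).scoreA = 0) ∧
    (((role E true t i (mind E t i)).walks = false ∨ (role E true t i (mind E t i)).lead = true) →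
      (mind E (t + (τ + 1)) i).scoreB = 0) := by
  induction τ with
  | zero =>
    rw [zero_add, mind_succ H.awake, H.upd_measure_zero hK]
    simp [Mem.clear]
  | succ τ ih =>
    obtain ⟨h1, -, h3⟩ := measure_const_succ (i := i) H hK (τ := τ) (by omega)
    obtain ⟨hA, hB⟩ := ih (by omega)
    rw [← add_assoc t, mind_succ (H.add hK hτ).awake,
      (H.add hK hτ).upd_measure hK (Nat.succ_ne_zero τ), Mem.tick_scoreA, Mem.tick_scoreB]
    constructor <;> intro h
    · simp only [Mem.count, Mem.gain, h1, h3, hA h]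
      rcases h with h | h <;> simp [h]
    · simp only [Mem.count, Mem.gain, h1, h3, hB h]
      rcases h with h | h <;> simp [h]

theorem place_of_measure (H : Sync E L (4 * (K * K)) 0 t) (hK : ∀ i, (E.id i).length = K)
    (hτ : τ < L) :
    ((role E true t i (mind E t i)).walks = true →
      (place E (t + (τ + 1)) i, failed E (t + (τ + 1)) i) = attempt (E.missing (t + τ))
        (place E (t + τ) i) (clockwise E i (role E true t i (mind E t i)).dir)) ∧
    ((role E true t i (mind E t i)).walks = false →
      place E (t + (τ + 1)) i = place E (t + τ) i) := by
  have H' := H.add hK hτ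
  have hact := H'.act_measure (i := i) hK
  have hc := measure_const (i := i) H hK hτ
  rw [hc.1, hc.2.1] at hact
  constructor <;> intro h <;> rw [h] at hact
  · exact place_of_go H'.awake hact
  · exact place_of_stay H'.awake hact

variable {a b c : Fin 3}

theorem place_thd_of_measure (H : Sync E L (4 * (K * K)) 0 t) (hK : ∀ i, (E.id i).length = K)
    (hR : Roles E (fun x => role E true t x (mind E t x)) a b c) (hτ : τ ≤ L) :
    place E (t + τ) c = place E t c := by
  induction τ with
  | zero => rfl
  | succ τ ih =>
    rw [(place_of_measure H hK hτ).2 hR.walks_thd]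
    exact ih (by omega)

/-- The standing agent is the only non-walker and never leaves its node, so hearing a non-walker
amounts to being at that node. -/
theorem scores_of_measure (H : Sync E L (4 * (K * K)) 0 t) (hK : ∀ i, (E.id i).length = K)
    (hcov : ∀ x, x = a ∨ x = b ∨ x = c)
    (hR : Roles E (fun x => role E true t x (mind E t x)) a b c) (hi : i = a ∨ i = b) :
    Scores (fun τ => place E (t + τ) i) (place E t c) (fun τ => failed E (t + τ) i)
      (fun τ => (mind E (t + τ) i).seen)
      (fun τ => if (role E true t i (mind E t i)).lead then (mind E (t + τ) i).scoreA
        else (mind E (t + τ) i).scoreB) L := by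
  have hw : ∀ x, x = a ∨ x = b → (role E true t x (mind E t x)).walks = true := by
    rintro x (rfl | rfl)
    exacts [hR.walks_fst, hR.walks_snd]
  have hci : c ≠ i := by
    rintro rfl
    exact Bool.false_ne_true (hR.walks_thd.symm.trans (hw c hi))
  have hmet : ∀ τ, 1 ≤ τ → τ < L → ((heard E (t + τ) i).any fun x => !(Mem.view x).1.walks) =
      decide (place E (t + τ) i = place E t c) := by
    intro τ h1 hτ
    obtain ⟨τ, rfl⟩ := Nat.exists_eq_add_of_le' h1
    rw [Bool.eq_iff_iff, any_heard (H.add hK hτ).awake, decide_eq_true_eq]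
    have hpc := place_thd_of_measure H hK hR hτ.le
    constructor
    · rintro ⟨j, hj, hp, hjw⟩
      rw [view_said, (measure_const_succ H hK (by omega)).1] at hjw
      rcases hcov j with rfl | rfl | rfl
      · rw [hw _ (.inl rfl)] at hjw; exact absurd hjw (by decide)
      · rw [hw _ (.inr rfl)] at hjw; exact absurd hjw (by decide)
      · rw [← hp, hpc]
    · intro hp
      refine ⟨c, hci, by rw [hpc, hp], ?_⟩
      rw [view_said, (measure_const_succ H hK (by omega)).1, hR.walks_thd]
      rfl
  have hupd : ∀ τ, 1 ≤ τ → τ < L → mind E (t + (τ + 1)) i =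
      ((mind E (t + τ) i).count (failed E (t + τ) i) (heard E (t + τ) i)).tick := by
    intro τ h1 hτ
    rw [← add_assoc, mind_succ (H.add hK hτ).awake, (H.add hK hτ).upd_measure hK (by omega)]
  constructor
  · rw [mind_succ H.awake, H.upd_measure_zero hK]
    simp [Mem.clear]
  · rw [mind_succ H.awake, H.upd_measure_zero hK]
    simp [Mem.clear]
  · intro τ h1 hτ
    rw [hupd τ h1 hτ, Mem.tick_scoreA, Mem.tick_scoreB]
    simp only [Mem.count, Mem.gain, hmet τ h1 hτ]
    obtain ⟨τ, rfl⟩ := Nat.exists_eq_add_of_le' h1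
    obtain ⟨c1, -, c2⟩ := measure_const_succ (i := i) H hK (τ := τ) (by omega)
    rw [c1, c2, hw i hi, (H.add hK hτ).len]
    cases (role E true t i (mind E t i)).lead <;> simp
  · intro τ h1 hτ
    rw [hupd τ h1 hτ, Mem.tick_seen]
    simp only [Mem.count, hmet τ h1 hτ]

/-- The messages are totally ordered: a pair yields two walkers, and a triple sends off its two
smallest messages, so the given `i`, `j` need not be the walkers. -/
theorem exists_roles (H : Sync E L (4 * (K * K)) 0 t) (hinj : Function.Injective E.id)
    {i j : Fin 3} (hij : i ≠ j) (hp : place E t i = place E t j) :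
    ∃ a b c, a ≠ b ∧ a ≠ c ∧ b ≠ c ∧ place E t a = place E t b ∧
      Roles E (fun x => role E true t x (mind E t x)) a b c := by
  obtain ⟨k, hik, hjk, -⟩ := exists_third hij
  wlog hlt : said E t i < said E t j generalizing i j with hwlog
  · exact hwlog hij.symm hp.symm hjk hik
      (lt_of_le_of_ne (not_lt.1 hlt) (H.said_ne hinj hij.symm))
  by_cases hk : place E t k = place E t i
  · rcases lt_or_gt_of_ne (H.said_ne hinj hjk) with h | h
    · exact ⟨i, j, k, hij, hik, hjk, hp, roles_of_triple H.awake hij hik hjk hp hk hlt h _⟩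
    · rcases lt_or_gt_of_ne (H.said_ne hinj hik) with h' | h'
      · exact ⟨i, k, j, hik, hij, hjk.symm, hk.symm,
          roles_of_triple H.awake hik hij hjk.symm hk.symm hp.symm h' h _⟩
      · exact ⟨k, i, j, hik.symm, hjk.symm, hij, hk,
          roles_of_triple H.awake hik.symm hjk.symm hij hk (hk.trans hp).symm h' hlt _⟩
  · exact ⟨i, j, k, hij, hik, hjk, hp, roles_of_pair H.awake hij hik hjk hp hk hlt true _⟩

/-- The outcome of the measurement: high scores certify that the ring is small and that it has been
explored, and the scores are high if two agents took part and the ring is small enough. -/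
theorem exists_scores (H : Sync E L (4 * (K * K)) 0 t) (hK : ∀ i, (E.id i).length = K)
    (hinj : Function.Injective E.id) (hn : 3 ≤ n) (hL : 0 < L) :
    ∃ α β, (∀ i, (mind E (t + L) i).scoreA ≤ α ∧ (mind E (t + L) i).scoreB ≤ β) ∧
      (L ≤ α + β → n ≤ L ∧ ∀ v, ∃ τ ≤ L, ∃ j, place E (t + τ) j = v) ∧
      ((∃ i j, i ≠ j ∧ place E t i = place E t j) → 4 * n ≤ L → L ≤ α + β ∧
        ∃ a b c, a ≠ b ∧ a ≠ c ∧ b ≠ c ∧ Roles E (mind E (t + L)) a b c ∧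
          α ≤ (mind E (t + L) a).scoreA ∧ β ≤ (mind E (t + L) b).scoreB) := by
  have hL1 : L - 1 < L := by omega
  have hLs : L - 1 + 1 = L := by omega
  by_cases hpair : ∃ i j, i ≠ j ∧ place E t i = place E t j
  · obtain ⟨i, j, hij, hp⟩ := hpair
    obtain ⟨a, b, c, hab, hac, hbc, hp, hR⟩ := exists_roles H hinj hij hp
    have hcov := cover hab hac hbc
    have hA := fun τ hτ => (place_of_measure (i := a) (τ := τ) H hK hτ).1 hR.walks_fst
    have hB := fun τ hτ => (place_of_measure (i := b) (τ := τ) H hK hτ).1 hR.walks_snd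
    simp only [hR.opposite] at hB
    have sA := scores_of_measure H hK hcov hR (.inl rfl)
    have sB := scores_of_measure H hK hcov hR (.inr rfl)
    simp only [hR.lead_fst, hR.lead_snd, if_true, if_false, Bool.false_eq_true] at sA sB
    have hz := fun x => measure_zero (i := x) H hK hL1
    rw [hLs] at hz
    refine ⟨(mind E (t + L) a).scoreA, (mind E (t + L) b).scoreB, fun x => ?_, fun h => ?_,
      fun _ h => ⟨?_, a, b, c, hab, hac, hbc, ?_, le_rfl, le_rfl⟩⟩
    · rcases hcov x with rfl | rfl | rfl
      · exact ⟨le_rfl, ((hz _).2 (.inr hR.lead_fst)).trans_le (Nat.zero_le _)⟩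
      · exact ⟨((hz _).1 (.inr hR.lead_snd)).trans_le (Nat.zero_le _), le_rfl⟩
      · exact ⟨((hz _).1 (.inl hR.walks_thd)).trans_le (Nat.zero_le _),
          ((hz _).2 (.inl hR.walks_thd)).trans_le (Nat.zero_le _)⟩
    · have hnL := le_of_le_scores (missing := fun τ => E.missing (t + τ)) hn hL hp hA hB sA sB h
      refine ⟨hnL, fun v => ?_⟩
      obtain ⟨τ, hτ, h | h⟩ := explored_of_opposite (x := fun τ => place E (t + τ) a)
        (y := fun τ => place E (t + τ) b) (bx := fun τ => failed E (t + τ) a)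
        (bz := fun τ => failed E (t + τ) b) (missing := fun τ => E.missing (t + τ))
        hn hnL hp hA hB v
      exacts [⟨τ, hτ, a, h⟩, ⟨τ, hτ, b, h⟩]
    · exact le_scores (missing := fun τ => E.missing (t + τ)) hn hL hA hB sA sB h
    · have hc := fun x => measure_const_succ (i := x) H hK hL1
      rw [hLs] at hc
      constructor
      · rw [(hc _).1]; exact hR.walks_fst
      · rw [(hc _).2.2]; exact hR.lead_fst
      · rw [(hc _).1]; exact hR.walks_snd
      · rw [(hc _).2.2]; exact hR.lead_snd
      · rw [(hc _).1]; exact hR.walks_thd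
      · rw [(hc _).2.1, (hc _).2.1]; exact hR.opposite
  -- With nobody together nobody walks, the cleared scores stay zero, and `0 < L` prevents any
  -- certificate.
  · refine ⟨0, 0, fun x => ?_, fun h => by omega, fun h => absurd h hpair⟩
    have hw : (role E true t x (mind E t x)).walks = false :=
      role_of_alone H.awake (fun j hj hp => hpair ⟨j, x, hj, hp⟩) _ _
    have hz := measure_zero (i := x) H hK hL1
    rw [hLs] at hz
    exact ⟨(hz.1 (.inl hw)).le, (hz.2 (.inl hw)).le⟩

end Measure

/-! ### A phase -/

section Phase

variable {n : ℕ} {E : Setting n} {t L s τ K : ℕ}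

theorem sync_slot (H : Sync E L 0 0 t) (hK : ∀ i, (E.id i).length = K) (hL : 0 < L)
    (hfin : ∀ i, (mind E t i).fin = false) (hs : s ≤ 4 * (K * K) + 3) :
    Sync E L s 0 (t + s * L) ∧ ∀ i, (mind E (t + s * L) i).fin = false := by
  induction s with
  | zero => simpa using ⟨H, hfin⟩
  | succ s ih =>
    obtain ⟨H', hf⟩ := ih (by omega)
    have hf' : ∀ τ ≤ L, ∀ i, (mind E (t + s * L + τ) i).fin = false := by
      intro τ
      induction τ with
      | zero => exact fun _ => hf
      | succ τ ih =>
        intro hτ i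
        rw [← add_assoc, (H'.add hK hτ).fin_succ hK (by omega)]
        exact ih (by omega) i
    rw [Nat.succ_mul, ← add_assoc]
    exact ⟨H'.next_slot hK hL (by omega), hf' L le_rfl⟩

variable (E) in
/-- After `T` rounds, and not before, all agents have terminated, and all nodes had been visited
before. -/
structure Done (T : ℕ) : Prop where
  awake : ∃ T', T = T' + 1 ∧ Awake E T'
  inactive : ∀ i, (conf E T).active i = false
  visited : ∀ v, ∃ s < T, ∃ j, place E s j = v

/-- In every phase, either all agents terminate, or the next phase begins, and the latter is
possible only if the slots are short. -/
theorem phase (H : Sync E L 0 0 t) (hK : ∀ i, (E.id i).length = K)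
    (hinj : Function.Injective E.id) (hn : 3 ≤ n) (hL : 2 ≤ L)
    (hfin : ∀ i, (mind E t i).fin = false) :
    Done E (t + (4 * (K * K) + 4) * L) ∨ L < 4 * n ∧
      Sync E (2 * L) 0 0 (t + (4 * (K * K) + 4) * L) ∧
      ∀ i, (mind E (t + (4 * (K * K) + 4) * L) i).fin = false := by
  have hL0 : 0 < L := by omega
  have H0 := (sync_slot H hK hL0 hfin (s := 4 * (K * K)) (by omega)).1
  have H1 := (sync_slot H hK hL0 hfin (s := 4 * (K * K) + 1) (by omega)).1
  have H2 := (sync_slot H hK hL0 hfin (s := 4 * (K * K) + 2) (by omega)).1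
  obtain ⟨H3, hfin3⟩ := sync_slot H hK hL0 hfin (s := 4 * (K * K) + 3) (by omega)
  have hmeet := exists_together_of_gather H hK hinj hn (L := L)
  set t0 := t + 4 * (K * K) * L with ht0
  have e1 : t + (4 * (K * K) + 1) * L = t0 + L := by rw [ht0]; ring
  have e2 : t + (4 * (K * K) + 2) * L = t0 + L + L := by rw [ht0]; ring
  have e3 : t + (4 * (K * K) + 3) * L = t0 + L + L + L := by rw [ht0]; ring
  have e4 : t + (4 * (K * K) + 4) * L = t0 + L + L + L + L := by rw [ht0]; ring
  rw [e1] at H1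
  rw [e2] at H2
  rw [e3] at H3 hfin3
  rw [e4]
  obtain ⟨α, β, hub, hsound, hcomp⟩ := exists_scores H0 hK hinj hn hL0
  have hub2 := scores_le H1 hK (by omega) (by omega) hub le_rfl
  have hub3 := scores_le H2 hK (by omega) (by omega) hub2 le_rfl
  have hub4 := scores_le H3 hK (by omega) (by omega) hub3 (τ := 1) (by omega)
  by_cases hhigh : ∃ i j, i ≠ j ∧ place E (t0 + L + L + L) i = place E (t0 + L + L + L) j ∧
      L ≤ (mind E (t0 + L + L + L + 1) i).scoreA + (mind E (t0 + L + L + L + 1) i).scoreB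
  · left
    obtain ⟨i, j, hij, hp, hle⟩ := hhigh
    -- Known scores never exceed the measured ones, so a high sum certifies exploration as well as
    -- `n ≤ L`, even in a short phase.
    obtain ⟨hnL, hvis⟩ := hsound (hle.trans (Nat.add_le_add (hub4 i).1 (hub4 i).2))
    refine ⟨⟨t0 + L + L + L + (L - 1), by omega, (H3.add hK (by omega)).awake⟩,
      inactive_of_high H3 hK hinj hn hnL hfin3 hij hp hle, fun v => ?_⟩
    obtain ⟨τ, hτ, j, h⟩ := hvis v
    exact ⟨t0 + τ, by omega, j, h⟩
  · right
    push Not at hhigh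
    refine ⟨?_, next_phase H3 hK hL hfin3 hhigh⟩
    by_contra! hLn
    obtain ⟨hαβ, a, b, c, hab, hac, hbc, hR, hα, hβ⟩ := hcomp (hmeet (by omega)) hLn
    obtain ⟨i, j, hij, hp⟩ := exists_together_of_roles H1 hK hn (by omega) hab hac hbc hR
    obtain ⟨k, hik, hjk, hcov⟩ := exists_third hij
    have hα2 := hα.trans (le_scores_later H1 hK (by omega) (by omega) (Nat.zero_le L) le_rfl a).1
    have hβ2 := hβ.trans (le_scores_later H1 hK (by omega) (by omega) (Nat.zero_le L) le_rfl b).2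
    -- Agent `i` merges with `j` at the start of the splitting slot and with `k` at the start of the
    -- last one. It thus knows everything, wherever the two scores were, and its sum contradicts
    -- `hhigh`.
    have key : ∀ i j, i ≠ j → (∀ x, x = i ∨ x = j ∨ x = k) → i ≠ k →
        place E (t0 + L + L) i = place E (t0 + L + L) j →
        place E (t0 + L + L + L) i = place E (t0 + L + L + L) k → False := by
      intro i j hij hcov hik hp hk
      have hA : ∀ x, (mind E (t0 + L + L) x).scoreA ≤
          (mind E (t0 + L + L + L + 1) i).scoreA := by
        intro x
        have h3 := (H3.scoreA_succ_le (i := i) hK (by omega) (by omega)).1 le_rfl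
        rcases hcov x with rfl | rfl | rfl
        · exact (le_scores_later H2 hK (by omega) (by omega) (Nat.zero_le L) le_rfl x).1.trans
            (h3 x rfl)
        · exact ((H2.scoreA_succ_le (i := i) hK (by omega) (by omega)).1 le_rfl x hp.symm).trans
            ((le_scores_later H2 hK (by omega) (by omega) hL0 le_rfl i).1.trans (h3 i rfl))
        · exact (le_scores_later H2 hK (by omega) (by omega) (Nat.zero_le L) le_rfl x).1.trans
            (h3 x hk.symm)
      have hB : ∀ x, (mind E (t0 + L + L) x).scoreB ≤
          (mind E (t0 + L + L + L + 1) i).scoreB := by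
        intro x
        have h3 := (H3.scoreB_succ_le (i := i) hK (by omega) (by omega)).1 le_rfl
        rcases hcov x with rfl | rfl | rfl
        · exact (le_scores_later H2 hK (by omega) (by omega) (Nat.zero_le L) le_rfl x).2.trans
            (h3 x rfl)
        · exact ((H2.scoreB_succ_le (i := i) hK (by omega) (by omega)).1 le_rfl x hp.symm).trans
            ((le_scores_later H2 hK (by omega) (by omega) hL0 le_rfl i).2.trans (h3 i rfl))
        · exact (le_scores_later H2 hK (by omega) (by omega) (Nat.zero_le L) le_rfl x).2.trans
            (h3 x hk.symm)
      have := hhigh i k hik hk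
      have := hα2.trans (hA a)
      have := hβ2.trans (hB b)
      omega
    rcases reach_of_split H2 hK hinj hn (ℓ := L) (.inl ⟨rfl, le_rfl⟩) (by omega) hij hik hjk hp
      with h | h
    · exact key i j hij hcov hik hp h
    · exact key j i hij.symm (fun x => by have := hcov x; tauto) hjk hp.symm h

/-! ### Summing the phases -/

theorem sync_zero : Sync E 4 0 0 0 ∧ ∀ i, (mind E 0 i).fin = false :=
  ⟨⟨fun _ => rfl, fun _ => rfl, fun _ => rfl, fun _ => rfl, fun _ => rfl⟩, fun _ => rfl⟩

/-- All agents have terminated in time. -/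
theorem exists_done (hK : ∀ i, (E.id i).length = K) (hinj : Function.Injective E.id)
    (hn : 3 ≤ n) (J : ℕ) (hJ : n ≤ 2 ^ J) :
    ∃ T, T + (4 * (K * K) + 4) * 4 ≤ (4 * (K * K) + 4) * (4 * 2 ^ (J + 1)) ∧ Done E T := by
  -- The geometric sum of the lengths is kept in the form `T + first = next`. The bound `2 ^ j < 2 *
  -- n` records that phase `j - 1` did not terminate.
  have key : ∀ j, (∃ T, T + (4 * (K * K) + 4) * 4 ≤ (4 * (K * K) + 4) * (4 * 2 ^ j) ∧ Done E T) ∨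
      ∃ T, T + (4 * (K * K) + 4) * 4 = (4 * (K * K) + 4) * (4 * 2 ^ j) ∧ (0 < j → 2 ^ j < 2 * n) ∧
        Sync E (4 * 2 ^ j) 0 0 T ∧ ∀ i, (mind E T i).fin = false := by
    intro j
    induction j with
    | zero => exact .inr ⟨0, by ring, by simp, by simpa using sync_zero⟩
    | succ j ih =>
      have e : (4 * (K * K) + 4) * (4 * 2 ^ (j + 1)) =
          (4 * (K * K) + 4) * (4 * 2 ^ j) + (4 * (K * K) + 4) * (4 * 2 ^ j) := by ring
      have hpos := Nat.one_le_two_pow (n := j)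
      rcases ih with ⟨T, hT, hD⟩ | ⟨T, hT, -, H, hfin⟩
      · exact .inl ⟨T, by omega, hD⟩
      · rcases phase H hK hinj hn (by omega) hfin with hD | ⟨hlt, H', hfin'⟩
        · exact .inl ⟨_, by omega, hD⟩
        · refine .inr ⟨_, by omega, fun _ => by rw [pow_succ]; omega, ?_, hfin'⟩
          rwa [show 4 * 2 ^ (j + 1) = 2 * (4 * 2 ^ j) by ring]
  rcases key (J + 1) with h | ⟨T, -, h, -⟩
  · exact h
  · have := h (by omega)
    rw [pow_succ] at this
    omega

theorem active_of_le {i : Fin 3} {r : ℕ} (h : (conf E s).active i = true) (hr : r ≤ s) :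
    (conf E r).active i = true := by
  induction hr using Nat.decreasingInduction with
  | self => exact h
  | of_succ r hr ih =>
    exact (Bool.and_eq_true_iff.1 (show ((conf E r).active i && _) = true from ih)).1

theorem Done.exploresWithin {T T' : ℕ} (h : Done E T) (hT : T ≤ T') :
    explore.ExploresWithin E T' := by
  refine ⟨fun v => ?_, fun i => ?_, fun s i hs v => ?_⟩
  · obtain ⟨s, hs, j, hj⟩ := h.visited v
    exact ⟨s, by omega, j, hj⟩
  · rw [Bool.eq_false_iff]
    exact fun hi => Bool.false_ne_true ((h.inactive i).symm.trans (active_of_le hi hT))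
  · obtain ⟨s', hs', j, hj⟩ := h.visited v
    -- All agents are active at `T₀`, so an inactive agent is only found at time `T₀ + 1` or later,
    -- after every node has been visited.
    obtain ⟨T₀, rfl, hA⟩ := h.awake
    refine ⟨s', ?_, j, hj⟩
    by_contra! hle
    have : (conf E s).active i = true := active_of_le (hA i) (by omega)
    exact Bool.false_ne_true (hs.symm.trans this)

end Phase

/-! ### Comparison with the stated bound -/

/-- The factor `2 ^ k` is needed only as `4 ≤ 2 ^ k`: this gives `32 k² + 32 ≤ 64 k² ≤ 16 k² 2 ^ k`,
and the term `23 n` is slack. -/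
theorem le_roundBound {k n : ℕ} (hk : 1 < k) :
    (4 * (k * k) + 4) * (4 * 2 ^ (Nat.clog 2 n + 1)) ≤ roundBound k n := by
  have h1 : 2 ^ 2 ≤ 2 ^ k := Nat.pow_le_pow_right (by norm_num) hk
  have h2 : 2 * 2 ≤ k * k := Nat.mul_le_mul hk hk
  calc (4 * (k * k) + 4) * (4 * 2 ^ (Nat.clog 2 n + 1))
      = (32 * (k * k) + 32) * 2 ^ Nat.clog 2 n := by ring
    _ ≤ (k * k * 2 ^ k * 16) * 2 ^ Nat.clog 2 n := by
        refine Nat.mul_le_mul_right _ ?_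
        have : k * k * 2 ^ 2 ≤ k * k * 2 ^ k := Nat.mul_le_mul_left _ h1
        omega
    _ = k ^ 2 * 2 ^ (k + Nat.clog 2 n + 4) := by ring
    _ ≤ roundBound k n := Nat.le_add_right _ _

/-- Rounding `n` up to a power of two at most doubles it, whence `55 = 16 * 2 + 23`. -/
theorem roundBound_le {k n : ℕ} (hk : 1 < k) (hn : 3 ≤ n) :
    roundBound k n ≤ 55 * (k ^ 2 * 2 ^ k * n) := by
  have h1 : 2 ^ Nat.clog 2 n ≤ 2 * n := by
    have h2 := Nat.pow_pred_clog_lt_self (b := 2) (by norm_num) (show 1 < n by omega)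
    have h3 : 0 < Nat.clog 2 n := Nat.clog_pos (by norm_num) (by omega)
    obtain ⟨m, hm⟩ := Nat.exists_eq_succ_of_ne_zero h3.ne'
    rw [hm] at h2 ⊢
    rw [Nat.pow_succ]
    simp at h2
    omega
  have h4 : 1 ≤ k ^ 2 * 2 ^ k := Nat.mul_pos (by positivity) (by positivity)
  calc roundBound k n = k ^ 2 * 2 ^ k * 16 * 2 ^ Nat.clog 2 n + 23 * n := by
        rw [roundBound]; ring
    _ ≤ k ^ 2 * 2 ^ k * 16 * (2 * n) + 23 * (k ^ 2 * 2 ^ k * n) :=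
        Nat.add_le_add (Nat.mul_le_mul_left _ h1)
          (Nat.mul_le_mul_left _ (Nat.le_mul_of_pos_left n h4))
    _ = 55 * (k ^ 2 * 2 ^ k * n) := by ring

end DynRing

theorem mainTheorem1 :
    (∃ A : DynRing.Algorithm, ∀ (k n : ℕ), 1 < k → 3 ≤ n → ∀ E : DynRing.Setting n,
      (∀ i, (E.id i).length = k) → Function.Injective E.id →
        A.ExploresWithin E (DynRing.roundBound k n)) ∧
    (∃ C : ℕ, ∀ (k n : ℕ), 1 < k → 3 ≤ n →
      DynRing.roundBound k n ≤ C * (k ^ 2 * 2 ^ k * n)) := by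
  refine ⟨⟨DynRing.explore, fun k n hk hn E hK hinj => ?_⟩,
    55, fun k n hk hn => DynRing.roundBound_le hk hn⟩
  obtain ⟨T, hT, hD⟩ := DynRing.exists_done hK hinj hn (Nat.clog 2 n)
    (Nat.le_pow_clog (by norm_num) n)
  exact hD.exploresWithin ((Nat.le_of_add_right_le hT).trans (DynRing.le_roundBound hk))
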